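/- Let $L=\{P,R,Q_1,Q_2\}$, where $P,R$ are unary and $Q_1,Q_2$ are binary relation symbols. Let $\tilde M$ be the $L$-structure whose universe is the disjoint union of the set of all finite subsets of $\omega$ and the set of all triples $(u,v,i)$ such that $u,v\subseteq\omega$ are finite, $i<\omega$, and $i<|v|+1$ whenever $u\subseteq v$; here $P^{\tilde M}$ is the set of finite subsets of $\omega$, $R^{\tilde M}=\tilde M\setminus P^{\tilde M}$, $Q_1^{\tilde M}$ is the set of all pairs $(u,(u,v,i))$ and $Q_2^{\tilde M}$ is the set of all pairs $(v,(u,v,i))$, where $(u,v,i)$ ranges over the triples in $\tilde M$. Let $T=\mathrm{Th}(\tilde M)$. If $M\prec M_1$ are models of $T$, call the pair $(M_1,M)$ weakly generic if every $L$-formula $\varphi(x)$ in one variable $x$, with parameters from $M$, which has infinitely many solutions in $M$, has a solution in $M_1\setminus M$. Theorem. The theory $T$ is $\omega$-stable (that is, for every $n<\omega$ there are at most countably many complete $n$-types over any countable subset of a model of $T$), and for every weakly generic pair $M\prec M_1$ of models of $T$, the theory of the pair $(M_1,M)$, i.e. the complete theory of $M_1$ in the language $L$ extended by a new unary predicate interpreted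 as $M$, has the independence property: there are a formula $\varphi(x,y)$ ($x,y$ finite tuples of variables) of the extended language and tuples $a_i,b_s$ $(i<\omega,\ s\subseteq\omega)$ in some model of this theory such that $\varphi(a_i,b_s)$ holds if and only if $i\in s$. In particular, there exists an $\omega$-stable theory such that for every weakly generic pair of its models the theory of the pair has the independence property. -/

import Mathlib

open FirstOrder

universe u v w

namespace GenericPair

section General

/-- A first-order theory is `ω`-stable if, over every countable set `A` of parameters in a model
`M`, there are at most countably many complete `n`-types (in the sense of `Th(M, a)_{a ∈ A}`),
for every `n`. -/
def IsOmegaStable {L : FirstOrder.Language.{u, v}} (T : L.Theory) : Prop :=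
  ∀ (M : Type w) [L.Structure M] [Nonempty M], M ⊨ T →
    ∀ A : Set M, A.Countable →
      ∀ n : ℕ, Countable ((L[[A]].completeTheory M).CompleteType (Fin n))

/-- A first-order theory has the independence property if in some model there are a formula
`φ(x, y)` (`x`, `y` finite tuples of variables) and tuples `a i`, `b s`, for `i < ω`, `s ⊆ ω`,
such that `φ (a i, b s)` holds if and only if `i ∈ s`. -/
def HasIndependenceProperty {L : FirstOrder.Language.{u, v}} (T : L.Theory) : Prop :=
  ∃ (m k : ℕ) (φ : L.Formula (Fin m ⊕ Fin k)) (N : FirstOrder.Language.Theory.ModelType.{u, v, max u v} T)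
    (a : ℕ → Fin m → N) (b : Set ℕ → Fin k → N),
    ∀ (i : ℕ) (s : Set ℕ), φ.Realize (Sum.elim (a i) (b s)) ↔ i ∈ s

variable {L : FirstOrder.Language.{u, v}} {M₁ : Type w} [L.Structure M₁]

/-- The pair `M ≺ M₁` is weakly generic if every formula `φ(x)` in one variable, with parameters
from `M`, which has infinitely many solutions in `M`, has a solution in `M₁ \ M`. -/
def IsWeaklyGeneric (M : L.ElementarySubstructure M₁) : Prop :=
  ∀ (n : ℕ) (φ : L.Formula (Fin n ⊕ Unit)) (c : Fin n → M),
    {x : M | φ.Realize (Sum.elim c fun _ => x)}.Infinite →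
      ∃ y : M₁, y ∉ M ∧ φ.Realize (Sum.elim (fun i => (c i : M₁)) fun _ => y)

/-- The only symbol naming the small model: one unary predicate. -/
inductive NameRel : ℕ → Type
  | name : NameRel 1

/-- The language consisting of one unary predicate. -/
def nameLanguage : FirstOrder.Language.{0, 0} := ⟨fun _ => Empty, NameRel⟩

/-- `M₁` as a structure in which the unary predicate is interpreted as the subset `S`. -/
abbrev nameStructure (S : Set M₁) : nameLanguage.Structure M₁ where
  funMap := fun f => Empty.elim f
  RelMap := fun r x => match r with
    | NameRel.name => x 0 ∈ S

/-- The theory of the pair `(M₁, M)`: the complete theory of `M₁` in the language `L` extended by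
a new unary predicate which names `M`. -/
def pairTheory (M : L.ElementarySubstructure M₁) : (L.sum nameLanguage).Theory :=
  letI : nameLanguage.Structure M₁ := nameStructure (M : Set M₁)
  (L.sum nameLanguage).completeTheory M₁

end General

/-- The relation symbols: `P`, `R` are unary, `Q₁`, `Q₂` are binary. -/
inductive TripleRel : ℕ → Type
  | P : TripleRel 1
  | R : TripleRel 1
  | Q₁ : TripleRel 2
  | Q₂ : TripleRel 2

/-- The language `{P, R, Q₁, Q₂}`. -/
def tripleLanguage : FirstOrder.Language.{0, 0} := ⟨fun _ => Empty, TripleRel⟩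

/-- The triples `(u, v, i)` with `u`, `v` finite subsets of `ω` and `i < ω`, such that
`i < |v| + 1` whenever `u ⊆ v`. -/
structure Triple where
  fst : Finset ℕ
  snd : Finset ℕ
  idx : ℕ
  idx_lt : fst ⊆ snd → idx < snd.card + 1

/-- The universe of the structure: the disjoint union of the set of all finite subsets of `ω` and
the set of triples. -/
abbrev TripleModel : Type := Finset ℕ ⊕ Triple

/-- `P` is the set of finite subsets of `ω`, `R` is its complement, `Q₁` relates `u` to each
`(u, v, i)`, and `Q₂` relates `v` to each `(u, v, i)`. -/
instance tripleStructure : tripleLanguage.Structure TripleModel where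
  funMap := fun f => Empty.elim f
  RelMap := fun r x => match r with
    | TripleRel.P => ∃ u : Finset ℕ, x 0 = Sum.inl u
    | TripleRel.R => ¬ ∃ u : Finset ℕ, x 0 = Sum.inl u
    | TripleRel.Q₁ => ∃ t : Triple, x 0 = Sum.inl t.fst ∧ x 1 = Sum.inr t
    | TripleRel.Q₂ => ∃ t : Triple, x 0 = Sum.inl t.snd ∧ x 1 = Sum.inr t

/-- The complete theory of the structure of finite sets and triples. -/
def tripleTheory : tripleLanguage.Theory := tripleLanguage.completeTheory TripleModel

end GenericPair

/-! Call the set of triples with coordinates `u`, `v` the fibre over `(u, v)`. In the standard model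
it has `|v| + 1` elements if `u ⊆ v` and is infinite otherwise.

Independence property: let `M ≺ M₁` be weakly generic. A finite fibre over elements of `M` gains no
element in `M₁`, because its size is first order; an infinite one does gain an element. Hence "every
triple over `(x, y)` lies in `M`" expresses, for sets of `M`, that the fibre is finite, which for
finite sets of atoms (singletons) means inclusion. All subsets of a finite set of atoms are
available, and compactness finishes (`hasIndependenceProperty_pairTheory`).

Stability: in `L` alone, inclusion is visible only one cardinality at a time, since `FibreCard n u
v` says that `u ⊆ v` and `|v| = n`. In an arbitrary model the sets of finite size ("standard") are
the finite sets of atoms, and every fibre involving any other set is infinite (`TripleGeometry`). In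
an ultrapower, which is `ℵ₁`-saturated, countable partial automorphisms closed under coordinates and
elements form a back-and-forth system (`IsRich.extend`), so they preserve all formulas. A countable
parameter set lies in a countable closed set `C`, and the identity on `C` extends so as to move any
tuple into one fixed countable set `U` (`exists_countable_isRich`). Since the ultrapower realizes
all types over the parameters, there are only countably many. -/

namespace GenericPair
open FirstOrder.Language

/-! ### Conditions defined by the same formula in two structures -/

section BothDefinable

variable {L : FirstOrder.Language.{u, v}} {M : Type*} {N : Type*} [L.Structure M] [L.Structure N]
  {α : Type}

/-- One and the same formula defines the first relation in `M` and the second one in `N`. -/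
def BothDefinable (L : FirstOrder.Language.{u, v}) {M : Type*} {N : Type*} [L.Structure M]
    [L.Structure N] {α : Type} (S : (α → M) → Prop) (S' : (α → N) → Prop) : Prop :=
  ∃ φ : L.Formula α, (∀ x, φ.Realize x ↔ S x) ∧ ∀ x, φ.Realize x ↔ S' x

namespace BothDefinable

theorem not {S : (α → M) → Prop} {S' : (α → N) → Prop} (h : BothDefinable L S S') :
    BothDefinable L (fun x => ¬ S x) (fun x => ¬ S' x) := by
  obtain ⟨φ, h₁, h₂⟩ := h
  exact ⟨φ.not, fun x => by simp [h₁], fun x => by simp [h₂]⟩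

theorem and {S T : (α → M) → Prop} {S' T' : (α → N) → Prop} (h : BothDefinable L S S')
    (k : BothDefinable L T T') :
    BothDefinable L (fun x => S x ∧ T x) (fun x => S' x ∧ T' x) := by
  obtain ⟨φ, h₁, h₂⟩ := h
  obtain ⟨ψ, k₁, k₂⟩ := k
  exact ⟨φ ⊓ ψ, fun x => by simp [h₁, k₁], fun x => by simp [h₂, k₂]⟩

theorem imp {S T : (α → M) → Prop} {S' T' : (α → N) → Prop} (h : BothDefinable L S S')
    (k : BothDefinable L T T') :
    BothDefinable L (fun x => S x → T x) (fun x => S' x → T' x) := by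
  obtain ⟨φ, h₁, h₂⟩ := h
  obtain ⟨ψ, k₁, k₂⟩ := k
  exact ⟨φ.imp ψ, fun x => by simp [h₁, k₁], fun x => by simp [h₂, k₂]⟩

theorem iff {S T : (α → M) → Prop} {S' T' : (α → N) → Prop} (h : BothDefinable L S S')
    (k : BothDefinable L T T') :
    BothDefinable L (fun x => S x ↔ T x) (fun x => S' x ↔ T' x) := by
  obtain ⟨φ, h₁, h₂⟩ := h
  obtain ⟨ψ, k₁, k₂⟩ := k
  exact ⟨φ.iff ψ, fun x => by simp [h₁, k₁], fun x => by simp [h₂, k₂]⟩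

theorem forall_index {β : Type} [Finite β] {S : β → (α → M) → Prop} {S' : β → (α → N) → Prop}
    (h : ∀ b, BothDefinable L (S b) (S' b)) :
    BothDefinable L (fun x => ∀ b, S b x) (fun x => ∀ b, S' b x) := by
  choose φ h₁ h₂ using h
  exact ⟨Formula.iInf φ, fun x => by simp [h₁], fun x => by simp [h₂]⟩

theorem exists_index {β : Type} [Finite β] {S : β → (α → M) → Prop} {S' : β → (α → N) → Prop}
    (h : ∀ b, BothDefinable L (S b) (S' b)) :
    BothDefinable L (fun x => ∃ b, S b x) (fun x => ∃ b, S' b x) := by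
  choose φ h₁ h₂ using h
  exact ⟨Formula.iSup φ, fun x => by simp [h₁], fun x => by simp [h₂]⟩

theorem exists_tuple {β : Type} [Finite β] {S : (α → M) → (β → M) → Prop}
    {S' : (α → N) → (β → N) → Prop}
    (h : BothDefinable L (fun x : α ⊕ β → M => S (fun a => x (Sum.inl a)) fun b => x (Sum.inr b))
      (fun x : α ⊕ β → N => S' (fun a => x (Sum.inl a)) fun b => x (Sum.inr b))) :
    BothDefinable L (fun x => ∃ z, S x z) (fun x => ∃ z, S' x z) := by
  obtain ⟨φ, h₁, h₂⟩ := h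
  exact ⟨φ.iExs β, fun x => by simp [h₁], fun x => by simp [h₂]⟩

theorem forall_tuple {β : Type} [Finite β] {S : (α → M) → (β → M) → Prop}
    {S' : (α → N) → (β → N) → Prop}
    (h : BothDefinable L (fun x : α ⊕ β → M => S (fun a => x (Sum.inl a)) fun b => x (Sum.inr b))
      (fun x : α ⊕ β → N => S' (fun a => x (Sum.inl a)) fun b => x (Sum.inr b))) :
    BothDefinable L (fun x => ∀ z, S x z) (fun x => ∀ z, S' x z) := by
  obtain ⟨φ, h₁, h₂⟩ := h
  exact ⟨φ.iAlls β, fun x => by simp [h₁], fun x => by simp [h₂]⟩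

theorem exists_elem {S : (α → M) → M → Prop} {S' : (α → N) → N → Prop}
    (h : BothDefinable L (fun x : α ⊕ Unit → M => S (fun a => x (Sum.inl a)) (x (Sum.inr ())))
      (fun x : α ⊕ Unit → N => S' (fun a => x (Sum.inl a)) (x (Sum.inr ())))) :
    BothDefinable L (fun x => ∃ z, S x z) (fun x => ∃ z, S' x z) := by
  obtain ⟨φ, h₁, h₂⟩ := exists_tuple (β := Unit) (S := fun x z => S x (z ()))
    (S' := fun x z => S' x (z ())) h
  exact ⟨φ, fun x => (h₁ x).trans ⟨fun ⟨z, hz⟩ => ⟨_, hz⟩, fun ⟨z, hz⟩ => ⟨fun _ => z, hz⟩⟩,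
    fun x => (h₂ x).trans ⟨fun ⟨z, hz⟩ => ⟨_, hz⟩, fun ⟨z, hz⟩ => ⟨fun _ => z, hz⟩⟩⟩

theorem forall_elem {S : (α → M) → M → Prop} {S' : (α → N) → N → Prop}
    (h : BothDefinable L (fun x : α ⊕ Unit → M => S (fun a => x (Sum.inl a)) (x (Sum.inr ())))
      (fun x : α ⊕ Unit → N => S' (fun a => x (Sum.inl a)) (x (Sum.inr ())))) :
    BothDefinable L (fun x => ∀ z, S x z) (fun x => ∀ z, S' x z) := by
  obtain ⟨φ, h₁, h₂⟩ := forall_tuple (β := Unit) (S := fun x z => S x (z ()))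
    (S' := fun x z => S' x (z ())) h
  exact ⟨φ, fun x => (h₁ x).trans ⟨fun hz z => hz fun _ => z, fun hz z => hz _⟩,
    fun x => (h₂ x).trans ⟨fun hz z => hz fun _ => z, fun hz z => hz _⟩⟩

theorem eq (i j : α) : BothDefinable L (fun x : α → M => x i = x j) (fun x : α → N => x i = x j) :=
  ⟨Term.equal (var i) (var j), fun x => by simp, fun x => by simp⟩

theorem rel₁ (r : L.Relations 1) (i : α) :
    BothDefinable L (fun x : α → M => Structure.RelMap r ![x i])
      (fun x : α → N => Structure.RelMap r ![x i]) :=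
  ⟨r.formula₁ (var i), fun x => by simp, fun x => by simp⟩

theorem rel₂ (r : L.Relations 2) (i j : α) :
    BothDefinable L (fun x : α → M => Structure.RelMap r ![x i, x j])
      (fun x : α → N => Structure.RelMap r ![x i, x j]) :=
  ⟨r.formula₂ (var i) (var j), fun x => by simp, fun x => by simp⟩

/-- Without free variables the common formula is a sentence. A property checked in the concrete
model thus passes to every model once its shape is rebuilt from the combinators above. -/
theorem transfer {p q : Prop} (hN : N ⊨ L.completeTheory M)
    (h : BothDefinable L (M := M) (N := N) (α := Empty) (fun _ => p) (fun _ => q)) (hp : p) : q := by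
  obtain ⟨φ, h₁, h₂⟩ := h
  refine (h₂ default).1 (hN.realize_of_mem (φ : L.Sentence) ?_)
  exact (h₁ default).2 hp

end BothDefinable

end BothDefinable

/-! ### Fibres and their cardinalities -/

section Relations

variable {N : Type*} [tripleLanguage.Structure N]

/-- `x` is a set. -/
def IsSet (x : N) : Prop := Structure.RelMap (L := tripleLanguage) TripleRel.P ![x]

/-- `x` is a triple. -/
def IsTriple (x : N) : Prop := Structure.RelMap (L := tripleLanguage) TripleRel.R ![x]

/-- `u` is the first coordinate of `z`. -/
def IsFst (u z : N) : Prop := Structure.RelMap (L := tripleLanguage) TripleRel.Q₁ ![u, z]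

/-- `v` is the second coordinate of `z`. -/
def IsSnd (v z : N) : Prop := Structure.RelMap (L := tripleLanguage) TripleRel.Q₂ ![v, z]

/-- The triples with the first two coordinates `u` and `v`. -/
def fibre (u v : N) : Set N := {z | IsFst u z ∧ IsSnd v z}

/-- There are at least `n` triples with first two coordinates `u` and `v`. -/
def FibreGE (n : ℕ) (u v : N) : Prop :=
  ∃ z : Fin n → N, (∀ i j, z i = z j → i = j) ∧ ∀ i, IsFst u (z i) ∧ IsSnd v (z i)

/-- There are exactly `n + 1` triples with first two coordinates `u` and `v`. -/
def FibreCard (n : ℕ) (u v : N) : Prop := FibreGE (n + 1) u v ∧ ¬ FibreGE (n + 2) u v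

theorem fibreGE_iff {n : ℕ} {u v : N} : FibreGE n u v ↔ (n : ℕ∞) ≤ (fibre u v).encard := by
  constructor
  · rintro ⟨z, hz, h⟩
    have h₁ : (Set.range z).encard = n := by
      rw [← Set.image_univ, Function.Injective.encard_image (fun i j => hz i j)]
      simp
    rw [← h₁]
    exact Set.encard_le_encard (by rintro _ ⟨i, rfl⟩; exact h i)
  · intro h
    obtain ⟨t, ht, hn⟩ := Set.exists_subset_encard_eq h
    have hf : t.Finite := Set.finite_of_encard_eq_coe hn
    have : Fintype t := hf.fintype
    have hc : Fintype.card t = n := by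
      rw [← Set.toFinset_card]
      rw [Set.encard_eq_coe_toFinset_card] at hn
      exact_mod_cast hn
    let e := (Fintype.equivFinOfCardEq hc).symm
    exact ⟨fun i => e i, fun i j hij => e.injective (Subtype.ext hij), fun i => ht (e i).2⟩

/-- The shift by one matches the bound `i < |v| + 1`, so that `n` is the size of `v` and not that of
the fibre. -/
theorem fibreCard_iff {n : ℕ} {u v : N} : FibreCard n u v ↔ (fibre u v).encard = n + 1 := by
  rw [FibreCard, fibreGE_iff, fibreGE_iff]
  cases h : (fibre u v).encard with
  | top => simp; exact_mod_cast ENat.top_ne_natCast (n+1)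
  | coe k => norm_cast; omega

end Relations

namespace BothDefinable

variable {M : Type*} {N : Type*} [tripleLanguage.Structure M] [tripleLanguage.Structure N]
  {α : Type}

theorem isSet (i : α) : BothDefinable tripleLanguage (fun x : α → M => IsSet (x i))
    (fun x : α → N => IsSet (x i)) := rel₁ _ i

theorem isTriple (i : α) : BothDefinable tripleLanguage (fun x : α → M => IsTriple (x i))
    (fun x : α → N => IsTriple (x i)) := rel₁ _ i

theorem isFst (i j : α) : BothDefinable tripleLanguage (fun x : α → M => IsFst (x i) (x j))
    (fun x : α → N => IsFst (x i) (x j)) := rel₂ _ i j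

theorem isSnd (i j : α) : BothDefinable tripleLanguage (fun x : α → M => IsSnd (x i) (x j))
    (fun x : α → N => IsSnd (x i) (x j)) := rel₂ _ i j

theorem const {L : FirstOrder.Language.{u, v}} {M : Type*} {N : Type*} [L.Structure M]
    [L.Structure N] {α : Type} (p : Prop) :
    BothDefinable L (fun _ : α → M => p) (fun _ : α → N => p) := by
  by_cases hp : p
  · exact ⟨⊤, fun x => by simp [hp], fun x => by simp [hp]⟩
  · exact ⟨⊥, fun x => by simp [hp], fun x => by simp [hp]⟩

theorem fibreGE (n : ℕ) (i j : α) :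
    BothDefinable tripleLanguage (fun x : α → M => FibreGE n (x i) (x j))
      (fun x : α → N => FibreGE n (x i) (x j)) :=
  exists_tuple <| and
    (forall_index fun k => forall_index fun l => (eq (Sum.inr k) (Sum.inr l)).imp (const _))
    (forall_index fun k => and (isFst (Sum.inl i) (Sum.inr k)) (isSnd (Sum.inl j) (Sum.inr k)))

theorem fibreCard (n : ℕ) (i j : α) :
    BothDefinable tripleLanguage (fun x : α → M => FibreCard n (x i) (x j))
      (fun x : α → N => FibreCard n (x i) (x j)) :=
  (fibreGE _ i j).and (fibreGE _ i j).not

end BothDefinable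

/-! ### First-order axioms and their verification -/

/-- The first-order properties of the structure of finite sets and triples which determine its
theory. -/
structure TripleAxioms (N : Type*) [tripleLanguage.Structure N] : Prop where
  isTriple_iff : ∀ z : N, IsTriple z ↔ ¬ IsSet z
  isFst_triple : ∀ u z : N, IsFst u z → ¬ IsSet z
  isSnd_triple : ∀ u z : N, IsSnd u z → ¬ IsSet z
  exists_fst : ∀ z : N, ¬ IsSet z → ∃ u, IsSet u ∧ ∀ u', IsFst u' z ↔ u' = u
  exists_snd : ∀ z : N, ¬ IsSet z → ∃ u, IsSet u ∧ ∀ u', IsSnd u' z ↔ u' = u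
  fibre_nonempty : ∀ u v : N, IsSet u → IsSet v → FibreGE 1 u v
  -- From here on read `FibreCard n u v` as "`u ⊆ v` and `|v| = n`", and `FibreCard 1 x x` as "`x`
  -- is a singleton". Sizes are fixed outside each axiom, and `m` in `card_left` is bounded, so that
  -- every instance is first order.
  card_right : ∀ (n : ℕ) (u v : N), FibreCard n u v → FibreCard n v v
  card_left : ∀ (n : ℕ) (u v : N), FibreCard n u v → ∃ m : Fin (n + 1), FibreCard m u u
  exists_elements : ∀ (n : ℕ) (v : N), FibreCard n v v → ∃ z : Fin n → N,
    (∀ i j, z i = z j → i = j) ∧ ∀ x, (FibreCard 1 x x ∧ FibreCard n x v) ↔ ∃ i, x = z i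
  subset_iff : ∀ (m n : ℕ) (u v : N), FibreCard m u u → FibreCard n v v →
    (FibreCard n u v ↔ ∀ x, FibreCard 1 x x → FibreCard m x u → FibreCard n x v)
  ext : ∀ (m n : ℕ) (u v : N), FibreCard m u u → FibreCard n v v →
    (∀ x, FibreCard 1 x x → (FibreCard m x u ↔ FibreCard n x v)) → u = v
  exists_set : ∀ (n : ℕ) (z : Fin n → N), (∀ i j, z i = z j → i = j) →
    (∀ i, FibreCard 1 (z i) (z i)) → ∃ v, FibreCard n v v ∧
      ∀ x, FibreCard 1 x x → (FibreCard n x v ↔ ∃ i, x = z i)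
  singleton_ext : ∀ x y : N, FibreCard 1 x x → FibreCard 1 y y → FibreCard 1 x y → x = y
  exists_atoms : ∀ n : ℕ, ∃ z : Fin n → N, (∀ i j, z i = z j → i = j) ∧ ∀ i, FibreCard 1 (z i) (z i)

/-- The constraint `idx_lt` is vacuous unless `u ⊆ v`, so the index runs through `Fin (v.card + 1)`
or through all of `ℕ`. -/
theorem encard_fibre_inl (u v : Finset ℕ) :
    (fibre (N := TripleModel) (Sum.inl u) (Sum.inl v)).encard =
      if u ⊆ v then (v.card : ℕ∞) + 1 else ⊤ := by
  let g : {i : ℕ // u ⊆ v → i < v.card + 1} → TripleModel := fun i => Sum.inr ⟨u, v, i, i.2⟩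
  have hg : g.Injective := by
    intro i j hij
    have := Triple.mk.inj (Sum.inr.inj hij)
    exact Subtype.ext this.2.2
  have h : fibre (N := TripleModel) (Sum.inl u) (Sum.inl v) = Set.range g := by
    ext z
    constructor
    · rintro ⟨⟨t, h₁, h₂⟩, ⟨t', h₃, h₄⟩⟩
      have h₂ : z = Sum.inr t := h₂
      have h₄ : z = Sum.inr t' := h₄
      have h₁ : u = t.fst := Sum.inl.inj h₁
      have h₃ : v = t'.snd := Sum.inl.inj h₃
      obtain rfl : t = t' := Sum.inr.inj (h₂.symm.trans h₄)
      subst h₁ h₃ h₂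
      exact ⟨⟨t.idx, t.idx_lt⟩, rfl⟩
    · rintro ⟨i, rfl⟩
      exact ⟨⟨⟨u, v, i, i.2⟩, rfl, rfl⟩, ⟨⟨u, v, i, i.2⟩, rfl, rfl⟩⟩
  rw [h, ← Set.image_univ, hg.encard_image, Set.encard_univ]
  split_ifs with huv
  · have e : {i : ℕ // u ⊆ v → i < v.card + 1} ≃ Fin (v.card + 1) :=
      (Equiv.subtypeEquivRight fun i => by simp [huv]).trans Fin.equivSubtype.symm
    rw [ENat.card_congr e]
    simp
  · have e : {i : ℕ // u ⊆ v → i < v.card + 1} ≃ ℕ :=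
      (Equiv.subtypeUnivEquiv fun i => by simp [huv])
    rw [ENat.card_congr e]
    simp

/-- A fibre of size `n + 1` is neither empty, which forces both arguments to be sets, nor infinite,
which forces inclusion. -/
theorem fibreCard_tripleModel {n : ℕ} {x y : TripleModel} :
    FibreCard n x y ↔ ∃ u v : Finset ℕ, x = Sum.inl u ∧ y = Sum.inl v ∧ u ⊆ v ∧ v.card = n := by
  constructor
  · intro h
    have hne : (fibre x y).Nonempty := by
      rw [Set.nonempty_iff_ne_empty]
      intro h0
      rw [fibreCard_iff, h0] at h
      rw [Set.encard_empty] at h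
      norm_cast at h
    obtain ⟨z, ⟨t, rfl, -⟩, ⟨t', rfl, -⟩⟩ := hne
    rw [fibreCard_iff] at h
    erw [encard_fibre_inl] at h
    refine ⟨_, _, rfl, rfl, ?_⟩
    split_ifs at h with hs
    · refine ⟨hs, ?_⟩
      norm_cast at h
      omega
    · exact absurd h (by norm_cast)
  · rintro ⟨u, v, rfl, rfl, h, rfl⟩
    rw [fibreCard_iff, encard_fibre_inl, if_pos h]

theorem fibreCard_one_tripleModel {x : TripleModel} :
    FibreCard 1 x x ↔ ∃ a : ℕ, x = Sum.inl {a} := by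
  rw [fibreCard_tripleModel]
  constructor
  · rintro ⟨u, v, rfl, h, -, hv⟩
    obtain ⟨a, rfl⟩ := Finset.card_eq_one.1 hv
    exact ⟨a, h⟩
  · rintro ⟨a, rfl⟩
    exact ⟨_, _, rfl, rfl, subset_rfl, by simp⟩

theorem fibreCard_inl {n : ℕ} {u v : Finset ℕ} :
    FibreCard (N := TripleModel) n (Sum.inl u) (Sum.inl v) ↔ u ⊆ v ∧ v.card = n := by
  rw [fibreCard_tripleModel]
  constructor
  · rintro ⟨u', v', h, h', k⟩
    rw [Sum.inl.inj h, Sum.inl.inj h']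
    exact k
  · exact fun h => ⟨u, v, rfl, rfl, h⟩

theorem tripleAxioms_tripleModel : TripleAxioms TripleModel where
  isTriple_iff z := Iff.rfl
  isFst_triple u z := by
    rintro ⟨t, -, h⟩ ⟨u, k⟩
    exact Sum.inl_ne_inr (k.symm.trans h)
  isSnd_triple u z := by
    rintro ⟨t, -, h⟩ ⟨u, k⟩
    exact Sum.inl_ne_inr (k.symm.trans h)
  exists_fst z hz := by
    rcases z with u | t
    · exact absurd ⟨u, rfl⟩ hz
    · refine ⟨Sum.inl t.fst, ⟨_, rfl⟩, fun u' => ⟨?_, fun h => ⟨t, h, rfl⟩⟩⟩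
      rintro ⟨t', h, k⟩
      rw [Sum.inr.inj k]
      exact h
  exists_snd z hz := by
    rcases z with u | t
    · exact absurd ⟨u, rfl⟩ hz
    · refine ⟨Sum.inl t.snd, ⟨_, rfl⟩, fun u' => ⟨?_, fun h => ⟨t, h, rfl⟩⟩⟩
      rintro ⟨t', h, k⟩
      rw [Sum.inr.inj k]
      exact h
  fibre_nonempty := by
    rintro u v ⟨u, hu⟩ ⟨v, hv⟩
    obtain rfl : _ = Sum.inl u := hu
    obtain rfl : _ = Sum.inl v := hv
    rw [fibreGE_iff, encard_fibre_inl]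
    split_ifs <;> simp
  card_right n u v h := by
    obtain ⟨u, v, rfl, rfl, h, k⟩ := fibreCard_tripleModel.1 h
    exact fibreCard_inl.2 ⟨subset_rfl, k⟩
  card_left n u v h := by
    obtain ⟨u, v, rfl, rfl, hs, rfl⟩ := fibreCard_tripleModel.1 h
    exact ⟨⟨u.card, Nat.lt_succ_of_le (Finset.card_le_card hs)⟩, fibreCard_inl.2 ⟨subset_rfl, rfl⟩⟩
  exists_elements n v h := by
    obtain ⟨u, v, h, rfl, -, rfl⟩ := fibreCard_tripleModel.1 h
    let e := v.equivFin.symm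
    refine ⟨fun i => Sum.inl {(e i : ℕ)}, fun i j hij => ?_, fun x => ?_⟩
    · exact e.injective (Subtype.ext (Finset.singleton_injective (Sum.inl.inj hij)))
    · rw [fibreCard_one_tripleModel]
      constructor
      · rintro ⟨⟨a, rfl⟩, h⟩
        have ha : a ∈ v := by simpa using (fibreCard_inl.1 h).1
        exact ⟨e.symm ⟨a, ha⟩, by simp⟩
      · rintro ⟨i, rfl⟩
        exact ⟨⟨_, rfl⟩, fibreCard_inl.2 ⟨by simp, rfl⟩⟩
  subset_iff m n u v hu hv := by
    obtain ⟨_, u, -, rfl, -, rfl⟩ := fibreCard_tripleModel.1 hu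
    obtain ⟨_, v, -, rfl, -, rfl⟩ := fibreCard_tripleModel.1 hv
    simp only [fibreCard_one_tripleModel, fibreCard_inl, and_true, forall_exists_index,
      forall_eq_apply_imp_iff, Finset.singleton_subset_iff]
    rfl
  ext m n u v hu hv h := by
    obtain ⟨_, u, -, rfl, -, rfl⟩ := fibreCard_tripleModel.1 hu
    obtain ⟨_, v, -, rfl, -, rfl⟩ := fibreCard_tripleModel.1 hv
    simp only [fibreCard_one_tripleModel, fibreCard_inl, and_true, forall_exists_index,
      forall_eq_apply_imp_iff, Finset.singleton_subset_iff] at h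
    rw [Finset.ext h]
  exists_set n z hz hz' := by
    simp only [fibreCard_one_tripleModel] at hz' ⊢
    choose a ha using hz'
    have hinj : a.Injective := fun i j hij => hz i j (by rw [ha, ha, hij])
    refine ⟨Sum.inl (Finset.univ.map ⟨a, hinj⟩), fibreCard_inl.2 ⟨subset_rfl, by simp⟩, ?_⟩
    rintro x ⟨b, rfl⟩
    simp only [fibreCard_inl, ha]
    constructor
    · rintro ⟨h, -⟩
      obtain ⟨i, -, hi⟩ := Finset.mem_map.1 (Finset.singleton_subset_iff.1 h)
      exact ⟨i, by rw [← hi]; rfl⟩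
    · rintro ⟨i, hi⟩
      have : b = a i := Finset.singleton_injective (Sum.inl.inj hi)
      simp [this]
  singleton_ext x y hx hy h := by
    obtain ⟨a, rfl⟩ := fibreCard_one_tripleModel.1 hx
    obtain ⟨b, rfl⟩ := fibreCard_one_tripleModel.1 hy
    simpa using (fibreCard_inl.1 h).1
  exists_atoms n := by
    refine ⟨fun i => Sum.inl {(i : ℕ)}, fun i j hij => ?_, fun i => ?_⟩
    · exact Fin.ext (Finset.singleton_injective (Sum.inl.inj hij))
    · exact fibreCard_one_tripleModel.2 ⟨_, rfl⟩

/-! ### Transfer of the axioms to all models -/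

section Transfer
open BothDefinable
variable {N : Type*} [tripleLanguage.Structure N]

theorem tripleAxioms_of_model (hN : N ⊨ tripleTheory) : TripleAxioms N where
  isTriple_iff := transfer hN (forall_elem ((isTriple _).iff (isSet _).not))
    tripleAxioms_tripleModel.isTriple_iff
  isFst_triple := transfer hN (forall_elem <| forall_elem ((isFst _ _).imp (isSet _).not))
    tripleAxioms_tripleModel.isFst_triple
  isSnd_triple := transfer hN (forall_elem <| forall_elem ((isSnd _ _).imp (isSet _).not))
    tripleAxioms_tripleModel.isSnd_triple
  exists_fst := transfer hN (forall_elem <| (isSet _).not.imp <| exists_elem <| (isSet _).and <|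
      forall_elem ((isFst _ _).iff (BothDefinable.eq _ _)))
    tripleAxioms_tripleModel.exists_fst
  exists_snd := transfer hN (forall_elem <| (isSet _).not.imp <| exists_elem <| (isSet _).and <|
      forall_elem ((isSnd _ _).iff (BothDefinable.eq _ _)))
    tripleAxioms_tripleModel.exists_snd
  fibre_nonempty := transfer hN (forall_elem <| forall_elem <| (isSet _).imp <| (isSet _).imp <|
      fibreGE _ _ _)
    tripleAxioms_tripleModel.fibre_nonempty
  card_right n := transfer hN (forall_elem <| forall_elem <| (fibreCard _ _ _).imp <|
      fibreCard _ _ _)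
    (tripleAxioms_tripleModel.card_right n)
  card_left n := transfer hN (forall_elem <| forall_elem <| (fibreCard _ _ _).imp <|
      exists_index fun _ => fibreCard _ _ _)
    (tripleAxioms_tripleModel.card_left n)
  exists_elements n := transfer hN (forall_elem <| (fibreCard _ _ _).imp <| exists_tuple <|
      (forall_index fun i => forall_index fun j =>
        (BothDefinable.eq (Sum.inr i) (Sum.inr j)).imp (const _)).and <|
      forall_elem <| ((fibreCard _ _ _).and (fibreCard _ _ _)).iff <|
      exists_index fun i => BothDefinable.eq _ (Sum.inl (Sum.inr i)))
    (tripleAxioms_tripleModel.exists_elements n)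
  subset_iff m n := transfer hN (forall_elem <| forall_elem <| (fibreCard _ _ _).imp <|
      (fibreCard _ _ _).imp <| (fibreCard _ _ _).iff <| forall_elem <|
      (fibreCard _ _ _).imp <| (fibreCard _ _ _).imp <| fibreCard _ _ _)
    (tripleAxioms_tripleModel.subset_iff m n)
  ext m n := transfer hN (forall_elem <| forall_elem <| (fibreCard _ _ _).imp <|
      (fibreCard _ _ _).imp <| (forall_elem <|
      (fibreCard _ _ _).imp <| (fibreCard _ _ _).iff <| fibreCard _ _ _).imp <|
      BothDefinable.eq _ _)
    (tripleAxioms_tripleModel.ext m n)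
  exists_set n := transfer hN (forall_tuple <|
      (forall_index fun i => forall_index fun j =>
        (BothDefinable.eq (Sum.inr i) (Sum.inr j)).imp (const _)).imp <|
      (forall_index fun i => fibreCard _ (Sum.inr i) (Sum.inr i)).imp <|
      exists_elem <| (fibreCard _ _ _).and <| forall_elem <| (fibreCard _ _ _).imp <|
      (fibreCard _ _ _).iff <|
      exists_index fun i => BothDefinable.eq _ (Sum.inl (Sum.inl (Sum.inr i))))
    (tripleAxioms_tripleModel.exists_set n)
  singleton_ext := transfer hN (forall_elem <| forall_elem <| (fibreCard _ _ _).imp <|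
      (fibreCard _ _ _).imp <| (fibreCard _ _ _).imp <| BothDefinable.eq _ _)
    tripleAxioms_tripleModel.singleton_ext
  exists_atoms n := transfer hN (exists_tuple <|
      (forall_index fun i => forall_index fun j =>
        (BothDefinable.eq (Sum.inr i) (Sum.inr j)).imp (const _)).and <|
      forall_index fun i => fibreCard _ (Sum.inr i) (Sum.inr i))
    (tripleAxioms_tripleModel.exists_atoms n)

end Transfer

/-! ### The geometry of an arbitrary model -/

/-- A description of a model of the theory of finite sets and triples: the standard sets are
those which correspond, through `supp`, to the finite sets of atoms. -/
structure TripleGeometry (N : Type*) [tripleLanguage.Structure N] where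
  /-- The standard sets. -/
  std : Set N
  /-- The atoms of a standard set. -/
  supp : N → Finset N
  /-- The first coordinate. -/
  fst : N → N
  /-- The second coordinate. -/
  snd : N → N
  isTriple_iff : ∀ z : N, IsTriple z ↔ ¬ IsSet z
  isFst_iff : ∀ u z : N, IsFst u z ↔ ¬ IsSet z ∧ u = fst z
  isSnd_iff : ∀ u z : N, IsSnd u z ↔ ¬ IsSet z ∧ u = snd z
  isSet_fst : ∀ z, ¬ IsSet z → IsSet (fst z)
  isSet_snd : ∀ z, ¬ IsSet z → IsSet (snd z)
  isSet_of_std : ∀ v ∈ std, IsSet v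
  supp_injOn : Set.InjOn supp std
  std_of_mem_supp : ∀ v ∈ std, ∀ x ∈ supp v, x ∈ std
  supp_of_mem_supp : ∀ v ∈ std, ∀ x ∈ supp v, supp x = {x}
  exists_supp : ∀ s : Finset N, (∀ x ∈ s, x ∈ std ∧ supp x = {x}) → ∃ v ∈ std, supp v = s
  encard_fibre : ∀ u ∈ std, ∀ v ∈ std, supp u ⊆ supp v → (fibre u v).encard = (supp v).card + 1
  std_of_finite_fibre : ∀ u v, IsSet u → IsSet v → (fibre u v).Finite →
    u ∈ std ∧ v ∈ std ∧ supp u ⊆ supp v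
  infinite_atoms : {x | x ∈ std ∧ supp x = {x}}.Infinite

theorem TripleAxioms.exists_geometry {N : Type*} [tripleLanguage.Structure N]
    (h : TripleAxioms N) : Nonempty (TripleGeometry N) := by
  classical
  -- The union over all `n` is not a first-order condition; other models may contain sets of no
  -- finite size.
  let std : Set N := {v | ∃ n, FibreCard n v v}
  have hsize : ∀ v : N, ∃ n, v ∈ std → FibreCard n v v := fun v => by
    by_cases hv : v ∈ std
    · obtain ⟨n, hn⟩ := hv
      exact ⟨n, fun _ => hn⟩
    · exact ⟨0, fun k => absurd k hv⟩
  choose size hsize using hsize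
  have huniq : ∀ {m n : ℕ} {u v : N}, FibreCard m u v → FibreCard n u v → m = n := by
    intro m n u v hm hn
    rw [fibreCard_iff] at hm hn
    have := hm.symm.trans hn
    norm_cast at this
    omega
  have hsize' : ∀ {n : ℕ} {v : N}, FibreCard n v v → n = size v := fun hn =>
    huniq hn (hsize _ ⟨_, hn⟩)
  have hsupp : ∀ v : N, ∃ s : Finset N, v ∈ std →
      s.card = size v ∧ ∀ x, x ∈ s ↔ FibreCard 1 x x ∧ FibreCard (size v) x v := by
    intro v
    by_cases hv : v ∈ std
    · obtain ⟨z, hz, hz'⟩ := h.exists_elements _ _ (hsize v hv)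
      refine ⟨Finset.univ.map ⟨z, fun i j => hz i j⟩, fun _ => ⟨by simp, fun x => ?_⟩⟩
      rw [hz', Finset.mem_map]
      exact ⟨fun ⟨i, _, hi⟩ => ⟨i, hi.symm⟩, fun ⟨i, hi⟩ => ⟨i, Finset.mem_univ _, hi.symm⟩⟩
    · exact ⟨∅, fun k => absurd k hv⟩
  choose supp hsupp using hsupp
  have hatom_std : ∀ x : N, FibreCard 1 x x → x ∈ std := fun x hx => ⟨1, hx⟩
  have hatom_supp : ∀ x : N, FibreCard 1 x x → supp x = {x} := by
    intro x hx
    ext y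
    rw [(hsupp x ⟨1, hx⟩).2, ← hsize' hx, Finset.mem_singleton]
    exact ⟨fun hy => h.singleton_ext _ _ hy.1 hx hy.2, by rintro rfl; exact ⟨hx, hx⟩⟩
  have hatom : ∀ x : N, x ∈ std → supp x = {x} → FibreCard 1 x x := fun x hx hs =>
    (((hsupp x hx).2 x).1 (by simp [hs])).1
  have hsub : ∀ u ∈ std, ∀ v ∈ std, (FibreCard (size v) u v ↔ supp u ⊆ supp v) := by
    intro u hu v hv
    rw [h.subset_iff _ _ _ _ (hsize u hu) (hsize v hv)]
    constructor
    · intro hx x hxu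
      obtain ⟨h₁, h₂⟩ := ((hsupp u hu).2 x).1 hxu
      exact ((hsupp v hv).2 x).2 ⟨h₁, hx x h₁ h₂⟩
    · intro hs x h₁ h₂
      exact (((hsupp v hv).2 x).1 (hs (((hsupp u hu).2 x).2 ⟨h₁, h₂⟩))).2
  have hfst : ∀ z : N, ∃ u, ¬ IsSet z → IsSet u ∧ ∀ u', IsFst u' z ↔ u' = u := by
    intro z
    by_cases hz : IsSet z
    · exact ⟨z, fun k => absurd hz k⟩
    · obtain ⟨u, hu⟩ := h.exists_fst z hz
      exact ⟨u, fun _ => hu⟩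
  have hsnd : ∀ z : N, ∃ u, ¬ IsSet z → IsSet u ∧ ∀ u', IsSnd u' z ↔ u' = u := by
    intro z
    by_cases hz : IsSet z
    · exact ⟨z, fun k => absurd hz k⟩
    · obtain ⟨u, hu⟩ := h.exists_snd z hz
      exact ⟨u, fun _ => hu⟩
  choose fst hfst using hfst
  choose snd hsnd using hsnd
  have hFst : ∀ u z : N, IsFst u z ↔ ¬ IsSet z ∧ u = fst z := fun u z =>
    ⟨fun k => ⟨h.isFst_triple _ _ k, ((hfst z (h.isFst_triple _ _ k)).2 u).1 k⟩,
      fun k => ((hfst z k.1).2 u).2 k.2⟩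
  have hSnd : ∀ u z : N, IsSnd u z ↔ ¬ IsSet z ∧ u = snd z := fun u z =>
    ⟨fun k => ⟨h.isSnd_triple _ _ k, ((hsnd z (h.isSnd_triple _ _ k)).2 u).1 k⟩,
      fun k => ((hsnd z k.1).2 u).2 k.2⟩
  refine ⟨⟨std, supp, fst, snd, h.isTriple_iff, hFst, hSnd, fun z hz => (hfst z hz).1,
    fun z hz => (hsnd z hz).1, ?_, ?_, ?_, ?_, ?_, ?_, ?_, ?_⟩⟩
  · rintro v ⟨n, ⟨z, -, hz⟩, -⟩
    have h₁ := (hFst _ _).1 (hz 0).1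
    rw [h₁.2]
    exact (hfst _ h₁.1).1
  · intro u hu v hv huv
    refine h.ext _ _ _ _ (hsize u hu) (hsize v hv) fun x hx => ?_
    have h₁ := (hsupp u hu).2 x
    have h₂ := (hsupp v hv).2 x
    rw [huv] at h₁
    simpa [hx] using h₁.symm.trans h₂
  · exact fun v hv x hx => hatom_std _ (((hsupp v hv).2 x).1 hx).1
  · exact fun v hv x hx => hatom_supp _ (((hsupp v hv).2 x).1 hx).1
  · intro s hs
    let e := s.equivFin.symm
    obtain ⟨v, hv, hv'⟩ := h.exists_set s.card (fun i => (e i : N))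
      (fun i j hij => e.injective (Subtype.ext hij)) fun i => hatom _ (hs _ (e i).2).1 (hs _ (e i).2).2
    refine ⟨v, ⟨_, hv⟩, ?_⟩
    ext x
    rw [(hsupp v ⟨_, hv⟩).2, ← hsize' hv]
    constructor
    · rintro ⟨h₁, h₂⟩
      obtain ⟨i, rfl⟩ := (hv' x h₁).1 h₂
      exact (e i).2
    · intro hx
      have h₁ := hatom _ (hs _ hx).1 (hs _ hx).2
      exact ⟨h₁, (hv' x h₁).2 ⟨e.symm ⟨x, hx⟩, by simp⟩⟩
  · intro u hu v hv huv
    rw [(hsupp v hv).1]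
    exact fibreCard_iff.1 ((hsub u hu v hv).2 huv)
  · intro u v hu hv hfin
    obtain ⟨k, hk⟩ : ∃ k : ℕ, (fibre u v).encard = k := hfin.exists_encard_eq_coe
    have h₁ := fibreGE_iff.1 (h.fibre_nonempty u v hu hv)
    rw [hk] at h₁
    norm_cast at h₁
    -- Fibres over sets are nonempty, so a finite one has size `n + 1` for some `n`, which is what
    -- `FibreCard n` records.
    obtain ⟨n, rfl⟩ := Nat.exists_eq_add_of_le' h₁
    have hn : FibreCard n u v := fibreCard_iff.2 (by rw [hk]; norm_cast)
    have hv := h.card_right _ _ _ hn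
    obtain ⟨m, hu⟩ := h.card_left _ _ _ hn
    refine ⟨⟨_, hu⟩, ⟨_, hv⟩, (hsub u ⟨_, hu⟩ v ⟨_, hv⟩).1 ?_⟩
    rwa [← hsize' hv]
  · intro hfin
    obtain ⟨z, hz, hz'⟩ := h.exists_atoms (hfin.toFinset.card + 1)
    have := Finset.card_le_card_of_injOn (s := Finset.univ) (t := hfin.toFinset) z
      (fun i _ => by
        simpa using ⟨hatom_std _ (hz' i), hatom_supp _ (hz' i)⟩) (fun i _ j _ hij => hz i j hij)
    simp at this

theorem exists_geometry {N : Type*} [tripleLanguage.Structure N] (hN : N ⊨ tripleTheory) :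
    Nonempty (TripleGeometry N) :=
  (tripleAxioms_of_model hN).exists_geometry

/-! ### Back-and-forth systems -/

/-- A back-and-forth system of partial isomorphisms of relational structures preserves all
formulas. -/
theorem realize_iff_of_back_and_forth {L : FirstOrder.Language.{u, v}} [L.IsRelational]
    {M N : Type*} [L.Structure M] [L.Structure N] (I : Set (Set (M × N)))
    (heq : ∀ f ∈ I, ∀ p ∈ f, ∀ q ∈ f, p.1 = q.1 ↔ p.2 = q.2)
    (hrel : ∀ f ∈ I, ∀ (n : ℕ) (r : L.Relations n) (x : Fin n → M) (y : Fin n → N),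
      (∀ i, (x i, y i) ∈ f) → (Structure.RelMap r x ↔ Structure.RelMap r y))
    (forth : ∀ f ∈ I, ∀ c, ∃ g ∈ I, f ⊆ g ∧ ∃ d, (c, d) ∈ g)
    (back : ∀ f ∈ I, ∀ d, ∃ g ∈ I, f ⊆ g ∧ ∃ c, (c, d) ∈ g)
    {α : Type*} {n : ℕ} (φ : L.BoundedFormula α n) (f : Set (M × N)) (hf : f ∈ I)
    (x : α → M) (y : α → N) (hxy : ∀ a, (x a, y a) ∈ f)
    (xs : Fin n → M) (ys : Fin n → N) (hs : ∀ i, (xs i, ys i) ∈ f) :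
    φ.Realize x xs ↔ φ.Realize y ys := by
  have hterm : ∀ {n : ℕ} (f : Set (M × N)), (∀ a, (x a, y a) ∈ f) → ∀ (xs : Fin n → M)
      (ys : Fin n → N), (∀ i, (xs i, ys i) ∈ f) → ∀ t : L.Term (α ⊕ Fin n),
      (t.realize (Sum.elim x xs), t.realize (Sum.elim y ys)) ∈ f := by
    intro n f hxy xs ys hs t
    rcases t with (a | i) | ⟨F, -⟩
    · exact hxy a
    · exact hs i
    · exact isEmptyElim F
  induction φ generalizing f with
  | falsum => exact Iff.rfl
  | equal s t => exact heq f hf _ (hterm f hxy xs ys hs s) _ (hterm f hxy xs ys hs t)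
  | rel r t => exact hrel f hf _ r _ _ fun i => hterm f hxy xs ys hs (t i)
  | imp φ ψ h₁ h₂ =>
    rw [BoundedFormula.realize_imp, BoundedFormula.realize_imp]
    exact imp_congr (h₁ f hf hxy xs ys hs) (h₂ f hf hxy xs ys hs)
  | all φ h =>
    rw [BoundedFormula.realize_all, BoundedFormula.realize_all]
    have key : ∀ g ∈ I, f ⊆ g → ∀ c d, (c, d) ∈ g →
        (φ.Realize x (Fin.snoc xs c) ↔ φ.Realize y (Fin.snoc ys d)) := by
      intro g hg hfg c d hcd
      refine h g hg (fun a => hfg (hxy a)) _ _ fun i => ?_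
      refine Fin.lastCases ?_ (fun j => ?_) i
      · simpa using hcd
      · simpa using hfg (hs j)
    constructor
    · intro hx d
      obtain ⟨g, hg, hfg, c, hcd⟩ := back f hf d
      exact (key g hg hfg c d hcd).1 (hx c)
    · intro hy c
      obtain ⟨g, hg, hfg, d, hcd⟩ := forth f hf c
      exact (key g hg hfg c d hcd).2 (hy d)

instance : tripleLanguage.IsRelational := fun _ => inferInstanceAs (IsEmpty Empty)

/-! ### Closed partial automorphisms -/

namespace TripleGeometry

variable {N : Type*} [tripleLanguage.Structure N] (G : TripleGeometry N)

theorem mem_fibre_iff {u v z : N} : z ∈ fibre u v ↔ ¬ IsSet z ∧ u = G.fst z ∧ v = G.snd z := by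
  change IsFst u z ∧ IsSnd v z ↔ _
  rw [G.isFst_iff, G.isSnd_iff]
  tauto

/-- The atoms are the standard sets with themselves as only element. -/
def IsAtom (x : N) : Prop := x ∈ G.std ∧ G.supp x = {x}

theorem isAtom_of_mem_supp {v x : N} (hv : v ∈ G.std) (hx : x ∈ G.supp v) : G.IsAtom x :=
  ⟨G.std_of_mem_supp v hv x hx, G.supp_of_mem_supp v hv x hx⟩

/-- A partial automorphism whose domain and range are closed under coordinates and elements. -/
structure IsPartialAut (f : Set (N × N)) : Prop where
  inj : ∀ p ∈ f, ∀ q ∈ f, p.1 = q.1 ↔ p.2 = q.2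
  isSet : ∀ p ∈ f, IsSet p.1 ↔ IsSet p.2
  std : ∀ p ∈ f, p.1 ∈ G.std ↔ p.2 ∈ G.std
  fst : ∀ p ∈ f, ¬ IsSet p.1 → (G.fst p.1, G.fst p.2) ∈ f
  snd : ∀ p ∈ f, ¬ IsSet p.1 → (G.snd p.1, G.snd p.2) ∈ f
  supp : ∀ p ∈ f, p.1 ∈ G.std → ∀ x ∈ G.supp p.1, ∃ y ∈ G.supp p.2, (x, y) ∈ f
  supp' : ∀ p ∈ f, p.2 ∈ G.std → ∀ y ∈ G.supp p.2, ∃ x ∈ G.supp p.1, (x, y) ∈ f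

variable {G} {f : Set (N × N)}

namespace IsPartialAut

theorem symm (h : G.IsPartialAut f) : G.IsPartialAut (Prod.swap ⁻¹' f) where
  inj _ hp _ hq := (h.inj _ hp _ hq).symm
  isSet _ hp := (h.isSet _ hp).symm
  std _ hp := (h.std _ hp).symm
  fst _ hp hp' := h.fst _ hp (mt (h.isSet _ hp).1 hp')
  snd _ hp hp' := h.snd _ hp (mt (h.isSet _ hp).1 hp')
  supp _ hp := h.supp' _ hp
  supp' _ hp := h.supp _ hp

theorem relMap_iff (h : G.IsPartialAut f) (n : ℕ) (r : tripleLanguage.Relations n)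
    (x y : Fin n → N) (hxy : ∀ i, (x i, y i) ∈ f) :
    Structure.RelMap r x ↔ Structure.RelMap r y := by
  rcases r with _ | _ | _ | _
  · have key : ∀ x : Fin 1 → N, Structure.RelMap (L := tripleLanguage) TripleRel.P x ↔
        IsSet (x 0) := fun x => by rw [IsSet]; congr!; ext i; fin_cases i; rfl
    rw [key, key]
    exact h.isSet _ (hxy 0)
  · have key : ∀ x : Fin 1 → N, Structure.RelMap (L := tripleLanguage) TripleRel.R x ↔
        IsTriple (x 0) := fun x => by rw [IsTriple]; congr!; ext i; fin_cases i; rfl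
    rw [key, key, G.isTriple_iff, G.isTriple_iff]
    exact not_congr (h.isSet _ (hxy 0))
  · have key : ∀ x : Fin 2 → N, Structure.RelMap (L := tripleLanguage) TripleRel.Q₁ x ↔
        IsFst (x 0) (x 1) := fun x => by rw [IsFst]; congr!; ext i; fin_cases i <;> rfl
    rw [key, key, G.isFst_iff, G.isFst_iff, h.isSet _ (hxy 1)]
    exact and_congr_right fun hy => h.inj _ (hxy 0) _ (h.fst _ (hxy 1) (mt (h.isSet _ (hxy 1)).1 hy))
  · have key : ∀ x : Fin 2 → N, Structure.RelMap (L := tripleLanguage) TripleRel.Q₂ x ↔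
        IsSnd (x 0) (x 1) := fun x => by rw [IsSnd]; congr!; ext i; fin_cases i <;> rfl
    rw [key, key, G.isSnd_iff, G.isSnd_iff, h.isSet _ (hxy 1)]
    exact and_congr_right fun hy => h.inj _ (hxy 0) _ (h.snd _ (hxy 1) (mt (h.isSet _ (hxy 1)).1 hy))

theorem supp_subset (h : G.IsPartialAut f) {u u' v v' : N} (hu : (u, u') ∈ f) (hv : (v, v') ∈ f)
    (hus : u ∈ G.std) (hvs : v ∈ G.std) (huv : G.supp u ⊆ G.supp v) : G.supp u' ⊆ G.supp v' := by
  intro y hy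
  obtain ⟨x, hx, hxy⟩ := h.supp' _ hu ((h.std _ hu).1 hus) y hy
  obtain ⟨z, hz, hxz⟩ := h.supp _ hv hvs x (huv hx)
  have hzy : z = y := (h.inj _ hxz _ hxy).1 rfl
  rwa [← hzy]

theorem card_supp_le (h : G.IsPartialAut f) {v v' : N} (hv : (v, v') ∈ f) (hvs : v ∈ G.std) :
    (G.supp v).card ≤ (G.supp v').card := by
  choose! g hg hg' using h.supp _ hv hvs
  exact Finset.card_le_card_of_injOn g hg fun x hx y hy hxy => (h.inj _ (hg' x hx) _ (hg' y hy)).2 hxy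

/-- A finite fibre forces `u`, `v` to be standard with `supp u ⊆ supp v`. The map carries supports
to supports bijectively, so the inclusion and the size `|supp v| + 1` are preserved. -/
theorem encard_fibre (h : G.IsPartialAut f) {u u' v v' : N} (hu : (u, u') ∈ f) (hv : (v, v') ∈ f)
    (hus : IsSet u) (hvs : IsSet v) (hfin : (fibre u v).Finite) :
    (fibre u v).encard = (fibre u' v').encard := by
  obtain ⟨h₁, h₂, h₃⟩ := G.std_of_finite_fibre u v hus hvs hfin
  have h₁' := (h.std _ hu).1 h₁
  have h₂' := (h.std _ hv).1 h₂
  rw [G.encard_fibre u h₁ v h₂ h₃, G.encard_fibre u' h₁' v' h₂' (h.supp_subset hu hv h₁ h₂ h₃),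
    le_antisymm (h.card_supp_le hv h₂) (h.symm.card_supp_le (v := v') (v' := v) hv h₂')]

theorem insert (h : G.IsPartialAut f) {c d : N} (hc : ∀ y, (c, y) ∉ f) (hd : ∀ x, (x, d) ∉ f)
    (hset : IsSet c ↔ IsSet d) (hstd : c ∈ G.std ↔ d ∈ G.std)
    (hfst : ¬ IsSet c → (G.fst c, G.fst d) ∈ f) (hsnd : ¬ IsSet c → (G.snd c, G.snd d) ∈ f)
    (hsupp : c ∈ G.std → ∀ x ∈ G.supp c, ∃ y ∈ G.supp d, (x, y) ∈ insert (c, d) f)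
    (hsupp' : d ∈ G.std → ∀ y ∈ G.supp d, ∃ x ∈ G.supp c, (x, y) ∈ insert (c, d) f) :
    G.IsPartialAut (insert (c, d) f) where
  inj := by
    rintro p (rfl | hp) q (rfl | hq)
    · simp
    · refine ⟨fun k => absurd hq ?_, fun k => absurd hq ?_⟩
      · have := hc q.2
        rwa [show q = (c, q.2) from Prod.ext k.symm rfl]
      · have := hd q.1
        rwa [show q = (q.1, d) from Prod.ext rfl k.symm]
    · refine ⟨fun k => absurd hp ?_, fun k => absurd hp ?_⟩
      · have := hc p.2
        rwa [show p = (c, p.2) from Prod.ext k rfl]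
      · have := hd p.1
        rwa [show p = (p.1, d) from Prod.ext rfl k]
    · exact h.inj p hp q hq
  isSet := by
    rintro p (rfl | hp)
    exacts [hset, h.isSet p hp]
  std := by
    rintro p (rfl | hp)
    exacts [hstd, h.std p hp]
  fst := by
    rintro p (rfl | hp) k
    exacts [Or.inr (hfst k), Or.inr (h.fst p hp k)]
  snd := by
    rintro p (rfl | hp) k
    exacts [Or.inr (hsnd k), Or.inr (h.snd p hp k)]
  supp := by
    rintro p (rfl | hp) k
    · exact hsupp k
    · intro x hx
      obtain ⟨y, hy, hxy⟩ := h.supp p hp k x hx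
      exact ⟨y, hy, Or.inr hxy⟩
  supp' := by
    rintro p (rfl | hp) k
    · exact hsupp' k
    · intro x hx
      obtain ⟨y, hy, hxy⟩ := h.supp' p hp k x hx
      exact ⟨y, hy, Or.inr hxy⟩

end IsPartialAut

/-! ### Rich sets and extension of partial automorphisms -/

variable (G)

/-- The set `U` is large enough to extend all partial automorphisms with values in `U` whose range
belongs to the class `small`. -/
structure IsRich (U : Set N) (small : Set (Set N)) : Prop where
  -- Two instances matter: `U` everything with `small` the countable sets, for elementarity; and `U`
  -- countable with `small` the sets finite outside a closed set `C`, for counting types.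
  insert_mem : ∀ S ∈ small, ∀ x, insert x S ∈ small
  exists_atom : ∀ S ∈ small, ∃ x ∈ U, x ∉ S ∧ G.IsAtom x
  exists_nonstd : ∀ S ∈ small, ∃ x ∈ U, x ∉ S ∧ IsSet x ∧ x ∉ G.std
  exists_fibre : ∀ S ∈ small, ∀ u ∈ U, ∀ v ∈ U, IsSet u → IsSet v → (fibre u v).Infinite →
    ∃ z ∈ U, z ∉ S ∧ z ∈ fibre u v
  fibre_subset : ∀ u ∈ U, ∀ v ∈ U, IsSet u → IsSet v → (fibre u v).Finite → fibre u v ⊆ U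
  mem_of_supp : ∀ v ∈ G.std, (∀ x ∈ G.supp v, x ∈ U) → v ∈ U

/-- The partial automorphisms with values in `U` and range in the class `small`. -/
def partialAuts (U : Set N) (small : Set (Set N)) : Set (Set (N × N)) :=
  {f | G.IsPartialAut f ∧ (∀ p ∈ f, p.2 ∈ U) ∧ Prod.snd '' f ∈ small}

variable {G} {U : Set N} {small : Set (Set N)}

theorem IsRich.insert_mem_partialAuts (hU : G.IsRich U small) (hf : f ∈ G.partialAuts U small)
    {c d : N} (hd : d ∈ U) (h : G.IsPartialAut (insert (c, d) f)) :
    insert (c, d) f ∈ G.partialAuts U small := by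
  refine ⟨h, ?_, ?_⟩
  · rintro p (rfl | hp)
    exacts [hd, hf.2.1 p hp]
  · rw [Set.image_insert_eq]
    exact hU.insert_mem _ hf.2.2 _

theorem notMem_of_notMem_image {N : Type*} {f : Set (N × N)} {d : N} (hd : d ∉ Prod.snd '' f) (x : N) : (x, d) ∉ f :=
  fun h => hd ⟨_, h, rfl⟩

/-- Any fresh atom `d` serves as image: an atom is its own only element, so the new pair `(c, d)`
itself matches the supports. -/
theorem IsRich.extend_atom (hU : G.IsRich U small) (hf : f ∈ G.partialAuts U small) {c : N}
    (hc : G.IsAtom c) : ∃ g ∈ G.partialAuts U small, f ⊆ g ∧ ∃ d, (c, d) ∈ g := by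
  by_cases hcf : ∃ d, (c, d) ∈ f
  · exact ⟨f, hf, subset_rfl, hcf⟩
  rw [not_exists] at hcf
  obtain ⟨d, hdU, hdf, hd⟩ := hU.exists_atom _ hf.2.2
  have hcs := G.isSet_of_std c hc.1
  refine ⟨_, hU.insert_mem_partialAuts hf hdU (c := c) (hf.1.insert hcf (notMem_of_notMem_image hdf)
    (iff_of_true hcs (G.isSet_of_std d hd.1)) (iff_of_true hc.1 hd.1)
    (fun k => absurd hcs k) (fun k => absurd hcs k) ?_ ?_), Set.subset_insert _ _, d,
    Set.mem_insert _ _⟩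
  · simp [hc.2, hd.2]
  · simp [hc.2, hd.2]

theorem IsRich.extend_atoms (hU : G.IsRich U small) (s : Finset N) (hs : ∀ x ∈ s, G.IsAtom x)
    (hf : f ∈ G.partialAuts U small) :
    ∃ g ∈ G.partialAuts U small, f ⊆ g ∧ ∀ x ∈ s, ∃ d, (x, d) ∈ g := by
  classical
  induction s using Finset.induction_on with
  | empty => exact ⟨f, hf, subset_rfl, by simp⟩
  | insert a s ha ih =>
    obtain ⟨g, hg, hfg, h⟩ := ih fun x hx => hs x (Finset.mem_insert_of_mem hx)
    obtain ⟨k, hk, hgk, d, hd⟩ := hU.extend_atom hg (hs a (Finset.mem_insert_self _ _))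
    refine ⟨k, hk, hfg.trans hgk, fun x hx => ?_⟩
    rcases Finset.mem_insert.1 hx with rfl | hx
    · exact ⟨d, hd⟩
    · obtain ⟨e, he⟩ := h x hx
      exact ⟨e, hgk he⟩

/-- For standard `c` the image is forced once its atoms are mapped: it is the standard set formed by
their images. A nonstandard set has no elements to respect, so any fresh nonstandard set will do. -/
theorem IsRich.extend_set (hU : G.IsRich U small) (hf : f ∈ G.partialAuts U small) {c : N}
    (hc : IsSet c) : ∃ g ∈ G.partialAuts U small, f ⊆ g ∧ ∃ d, (c, d) ∈ g := by
  classical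
  by_cases hcs : c ∈ G.std
  · obtain ⟨g, hg, hfg, h⟩ := hU.extend_atoms (G.supp c) (fun x => G.isAtom_of_mem_supp hcs) hf
    by_cases hcg : ∃ d, (c, d) ∈ g
    · exact ⟨g, hg, hfg, hcg⟩
    rw [not_exists] at hcg
    choose! k hk using h
    have hk' : ∀ x ∈ G.supp c, G.IsAtom (k x) ∧ k x ∈ U := by
      intro x hx
      have hx' := G.isAtom_of_mem_supp hcs hx
      -- Since `x` belongs to its own support, its image `k x` belongs to the support of `k x`, and
      -- is therefore an atom.
      obtain ⟨y, hy, hxy⟩ := hg.1.supp _ (hk x hx) hx'.1 x (by simp [hx'.2])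
      have hyk : k x = y := ((hg.1.inj _ (hk x hx) _ hxy).1 rfl)
      refine ⟨G.isAtom_of_mem_supp ((hg.1.std _ (hk x hx)).1 hx'.1) ?_, hg.2.1 _ (hk x hx)⟩
      change k x ∈ G.supp (k x)
      exact hyk.symm ▸ hy
    obtain ⟨d, hd, hdk⟩ := G.exists_supp ((G.supp c).image k) fun x hx => by
      obtain ⟨y, hy, rfl⟩ := Finset.mem_image.1 hx
      exact (hk' y hy).1
    have hdU : d ∈ U := hU.mem_of_supp d hd fun x hx => by
      rw [hdk] at hx
      obtain ⟨y, hy, rfl⟩ := Finset.mem_image.1 hx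
      exact (hk' y hy).2
    -- A preimage of `d` would have the same support as `c`, hence equal `c`, which is not in the
    -- domain.
    have hdg : ∀ x, (x, d) ∉ g := by
      intro x hx
      refine hcg d ?_
      have hxs := (hg.1.std _ hx).2 hd
      suffices x = c by rwa [← this]
      refine G.supp_injOn hxs hcs ?_
      ext a
      constructor
      · intro ha
        obtain ⟨b, hb, hab⟩ := hg.1.supp _ hx hxs a ha
        rw [hdk] at hb
        obtain ⟨a', ha', rfl⟩ := Finset.mem_image.1 hb
        rwa [show a = a' from (hg.1.inj _ hab _ (hk a' ha')).2 rfl]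
      · intro ha
        have hb : k a ∈ G.supp d := by
          rw [hdk]
          exact Finset.mem_image_of_mem k ha
        obtain ⟨a', ha', hab⟩ := hg.1.supp' _ hx hd _ hb
        rwa [show a = a' from (hg.1.inj _ (hk a ha) _ hab).2 rfl]
    refine ⟨_, hU.insert_mem_partialAuts hg hdU (c := c) (hg.1.insert hcg hdg
      (iff_of_true hc (G.isSet_of_std d hd)) (iff_of_true hcs hd)
      (fun k => absurd hc k) (fun k => absurd hc k) (fun _ x hx => ?_) (fun _ y hy => ?_)),
      hfg.trans (Set.subset_insert _ _), d, Set.mem_insert _ _⟩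
    · exact ⟨k x, by rw [hdk]; exact Finset.mem_image_of_mem k hx, Or.inr (hk x hx)⟩
    · rw [hdk] at hy
      obtain ⟨x, hx, rfl⟩ := Finset.mem_image.1 hy
      exact ⟨x, hx, Or.inr (hk x hx)⟩
  · by_cases hcf : ∃ d, (c, d) ∈ f
    · exact ⟨f, hf, subset_rfl, hcf⟩
    rw [not_exists] at hcf
    obtain ⟨d, hdU, hdf, hd, hds⟩ := hU.exists_nonstd _ hf.2.2
    exact ⟨_, hU.insert_mem_partialAuts hf hdU (c := c) (hf.1.insert hcf
      (notMem_of_notMem_image hdf) (iff_of_true hc hd) (iff_of_false hcs hds)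
      (fun k => absurd hc k) (fun k => absurd hc k) (fun k => absurd k hcs) (fun k => absurd k hds)),
      Set.subset_insert _ _, d, Set.mem_insert _ _⟩

/-- A triple is determined by its coordinates up to the choice inside a fibre. After mapping the
coordinates, it suffices to find an unused element in the image fibre: richness gives one if that
fibre is infinite, counting if it is finite. -/
theorem IsRich.extend (hU : G.IsRich U small) (hf : f ∈ G.partialAuts U small) (c : N) :
    ∃ g ∈ G.partialAuts U small, f ⊆ g ∧ ∃ d, (c, d) ∈ g := by
  by_cases hc : IsSet c
  · exact hU.extend_set hf hc
  have hp := G.isSet_fst c hc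
  have hq := G.isSet_snd c hc
  obtain ⟨g₁, hg₁, hfg₁, p', hp'⟩ := hU.extend_set hf hp
  obtain ⟨g, hg, hfg, q', hq'⟩ := hU.extend_set hg₁ hq
  replace hp' := hfg hp'
  replace hfg := hfg₁.trans hfg
  clear hfg₁ hg₁ g₁
  by_cases hcg : ∃ d, (c, d) ∈ g
  · exact ⟨g, hg, hfg, hcg⟩
  rw [not_exists] at hcg
  have hps := (hg.1.isSet _ hp').1 hp
  have hqs := (hg.1.isSet _ hq').1 hq
  have hcF : c ∈ fibre (G.fst c) (G.snd c) := G.mem_fibre_iff.2 ⟨hc, rfl, rfl⟩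
  obtain ⟨d, hdU, hdg, hd⟩ : ∃ d ∈ U, (∀ x, (x, d) ∉ g) ∧ d ∈ fibre p' q' := by
    by_cases hfin : (fibre p' q').Finite
    · by_contra! hcon
      have hsub := hU.fibre_subset _ (hg.2.1 _ hp') _ (hg.2.1 _ hq') hps hqs hfin
      have hcard := hg.1.symm.encard_fibre (u := p') (v := q') (u' := G.fst c) (v' := G.snd c)
        hp' hq' hps hqs hfin
      have hpre : ∀ d ∈ fibre p' q', ∃ x, (x, d) ∈ g := fun d hd => by
        by_contra! hx
        exact hcon d (hsub hd) hx hd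
      choose! k hk using hpre
      -- If the whole fibre over `(p', q')` were used, preimages would inject it into the fibre of
      -- `c` with `c` removed, although both fibres have the same finite size.
      have hmaps : Set.MapsTo k (fibre p' q') (fibre (G.fst c) (G.snd c) \ {c}) := by
        intro d hd
        obtain ⟨h₁, h₂, h₃⟩ := G.mem_fibre_iff.1 hd
        have h₁' := mt (hg.1.isSet _ (hk d hd)).1 h₁
        refine ⟨G.mem_fibre_iff.2 ⟨h₁', ?_, ?_⟩, ?_⟩
        · exact (hg.1.inj _ hp' _ (hg.1.fst _ (hk d hd) h₁')).2 h₂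
        · exact (hg.1.inj _ hq' _ (hg.1.snd _ (hk d hd) h₁')).2 h₃
        · intro hkc
          exact hcg d (by rw [← show k d = c from hkc]; exact hk d hd)
      have hinj : Set.InjOn k (fibre p' q') := fun d hd e he hde =>
        (hg.1.inj _ (hk d hd) _ (hk e he)).1 hde
      have hle := Set.encard_le_encard_of_injOn hmaps hinj
      have hfin' : (fibre (G.fst c) (G.snd c)).Finite := by
        rw [← Set.encard_lt_top_iff, ← hcard]
        exact hfin.encard_lt_top
      have hlt : (fibre (G.fst c) (G.snd c) \ {c}).encard < (fibre (G.fst c) (G.snd c)).encard :=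
        Set.Finite.encard_lt_encard (hfin'.subset Set.sdiff_subset)
          ⟨Set.sdiff_subset, fun hs => (hs hcF).2 rfl⟩
      exact absurd hcard (hle.trans_lt hlt).ne
    · obtain ⟨d, h₁, h₂, h₃⟩ := hU.exists_fibre _ hg.2.2 _ (hg.2.1 _ hp') _ (hg.2.1 _ hq') hps hqs
        hfin
      exact ⟨d, h₁, notMem_of_notMem_image h₂, h₃⟩
  obtain ⟨hds, rfl, rfl⟩ := G.mem_fibre_iff.1 hd
  have hcs : c ∉ G.std := mt (G.isSet_of_std c) hc
  have hds' : d ∉ G.std := mt (G.isSet_of_std d) hds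
  exact ⟨_, hU.insert_mem_partialAuts hg hdU (c := c) (hg.1.insert hcg hdg (iff_of_false hc hds)
    (iff_of_false hcs hds') (fun _ => hp') (fun _ => hq') (fun k => absurd k hcs)
    (fun k => absurd k hds')), hfg.trans (Set.subset_insert _ _), d, Set.mem_insert _ _⟩

theorem IsPartialAut.countable (h : G.IsPartialAut f) (hf : (Prod.snd '' f).Countable) :
    f.Countable :=
  Set.countable_of_injective_of_countable_image
    (fun p hp q hq hpq => Prod.ext ((h.inj p hp q hq).2 hpq) hpq) hf

/-- If the whole model is rich with respect to countable sets, then countable partial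
automorphisms preserve all formulas. -/
theorem IsPartialAut.realize_iff (hG : G.IsRich Set.univ {S | S.Countable})
    (h : G.IsPartialAut f) (hf : f.Countable) {α : Type*} (φ : tripleLanguage.Formula α)
    (x y : α → N) (hxy : ∀ a, (x a, y a) ∈ f) : φ.Realize x ↔ φ.Realize y := by
  have forth : ∀ f ∈ {f | G.IsPartialAut f ∧ f.Countable}, ∀ c,
      ∃ g ∈ {f | G.IsPartialAut f ∧ f.Countable}, f ⊆ g ∧ ∃ d, (c, d) ∈ g := by
    rintro f ⟨h, hf⟩ c
    obtain ⟨g, hg, k⟩ := hG.extend (f := f) ⟨h, by simp, hf.image _⟩ c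
    exact ⟨g, ⟨hg.1, hg.1.countable hg.2.2⟩, k⟩
  refine realize_iff_of_back_and_forth {f | G.IsPartialAut f ∧ f.Countable} (fun f hf => hf.1.inj)
    (fun f hf => hf.1.relMap_iff) forth ?_ φ f ⟨h, hf⟩ x y hxy _ _ fun i => i.elim0
  -- Countability is symmetric in domain and range, so "back" is "forth" for the inverse.
  rintro f ⟨h, hf⟩ c
  obtain ⟨g, ⟨hg, hg'⟩, hfg, d, hd⟩ := forth _ ⟨h.symm, hf.preimage Prod.swap_injective⟩ c
  exact ⟨_, ⟨hg.symm, hg'.preimage Prod.swap_injective⟩, fun p hp => hfg (by simpa using hp), d, hd⟩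

end TripleGeometry

/-! ### Saturation of ultrapowers -/

/-- The ultrapower by a nonprincipal ultrafilter on `ℕ`. -/
abbrev Ultrapower (M : Type u) : Type u :=
  (Filter.hyperfilter ℕ : Filter ℕ).Product fun _ => M

/-- The diagonal embedding into the ultrapower. -/
noncomputable def Ultrapower.diag {M : Type u} (x : M) : Ultrapower M := ((fun _ => x : ℕ → M) : Ultrapower M)

theorem Ultrapower.exists_rep {M : Type*} {γ : Type*} (z : γ → Ultrapower M) :
    ∃ z' : γ → ℕ → M, z = fun i => ((z' i : ℕ → M) : Ultrapower M) := by
  choose z' hz' using fun i => Quotient.exists_rep (z i)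
  exact ⟨z', funext fun i => (hz' i).symm⟩

section Saturation

variable {L : FirstOrder.Language.{u, v}} {M : Type w} [L.Structure M] [Nonempty M]

theorem Ultrapower.realize_diag {α : Type*} (φ : L.Formula α) (x : α → M) :
    φ.Realize (fun a => Ultrapower.diag (x a)) ↔ φ.Realize x := by
  refine (Ultraproduct.realize_formula_cast φ fun a _ => x a).trans ?_
  simp

/-- The ultrapower is `ℵ₁`-saturated. -/
theorem Ultrapower.exists_realize {α β : Type*} (ψ : ℕ → L.Formula (α ⊕ β)) (c : α → Ultrapower M)
    (h : ∀ k, ∃ b : β → Ultrapower M, ∀ j < k, (ψ j).Realize (Sum.elim c b)) :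
    ∃ b : β → Ultrapower M, ∀ j, (ψ j).Realize (Sum.elim c b) := by
  classical
  have hlos : ∀ (c : α → ℕ → M) (b : β → ℕ → M) (φ : L.Formula (α ⊕ β)),
      φ.Realize (Sum.elim (fun i => ((c i : ℕ → M) : Ultrapower M))
        fun i => ((b i : ℕ → M) : Ultrapower M)) ↔
      ∀ᶠ i in (Filter.hyperfilter ℕ : Filter ℕ),
        φ.Realize (Sum.elim (fun a => c a i) fun a => b a i) := by
    intro c b φ
    have h₁ := Ultraproduct.realize_formula_cast (u := Filter.hyperfilter ℕ) (M := fun _ => M) φ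
      (Sum.elim c b)
    convert h₁ using 2
    · ext (i | i) <;> rfl
    · ext i
      congr! 1
      ext (i | i) <;> rfl
  obtain ⟨c, rfl⟩ := exists_rep c
  let p : ℕ → ℕ → Prop := fun i k =>
    ∃ b : β → M, ∀ j < k, (ψ j).Realize (Sum.elim (fun a => c a i) b)
  have hp : ∀ k, ∀ᶠ i in (Filter.hyperfilter ℕ : Filter ℕ), p i k := by
    intro k
    obtain ⟨b, hb⟩ := h k
    obtain ⟨b, rfl⟩ := exists_rep b
    have : ∀ᶠ i in (Filter.hyperfilter ℕ : Filter ℕ), ∀ j ∈ Finset.range k,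
        (ψ j).Realize (Sum.elim (fun a => c a i) fun a => b a i) :=
      (Filter.eventually_all_finset _).2 fun j hj => (hlos c b (ψ j)).1 (hb j (Finset.mem_range.1 hj))
    exact this.mono fun i hi => ⟨fun a => b a i, fun j hj => hi j (Finset.mem_range.2 hj)⟩
  -- In coordinate `i` choose a tuple satisfying the longest satisfiable initial segment of length
  -- at most `i`. For fixed `j`, almost every `i` satisfies `j + 1 ≤ i` and `p i (j + 1)`, so
  -- formula `j` holds there.
  have hspec : ∀ i, p i (Nat.findGreatest (p i) i) := fun i =>
    Nat.findGreatest_spec (P := p i) (Nat.zero_le i)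
      ⟨fun _ => Classical.arbitrary M, fun j hj => absurd hj (Nat.not_lt_zero j)⟩
  choose b hb using hspec
  refine ⟨fun a => ((fun i => b i a : ℕ → M) : Ultrapower M), fun j => ?_⟩
  refine (hlos c (fun a i => b i a) (ψ j)).2 ?_
  have hge : ∀ᶠ i in (Filter.hyperfilter ℕ : Filter ℕ), j + 1 ≤ i :=
    Nat.hyperfilter_le_atTop (Filter.eventually_ge_atTop (j + 1))
  filter_upwards [hge, hp (j + 1)] with i hi hpi
  exact hb i j (Nat.le_findGreatest hi hpi)

/-- In the ultrapower, a countable conjunction of conditions which can be finitely satisfied by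
infinitely many elements is satisfied outside any countable set. -/
theorem Ultrapower.exists_notMem {α : Type*} (θ : ℕ → L.Formula (α ⊕ Unit)) (c : α → Ultrapower M)
    (h : ∀ k, {x : Ultrapower M | ∀ j < k, (θ j).Realize (Sum.elim c fun _ => x)}.Infinite)
    {S : Set (Ultrapower M)} (hS : S.Countable) :
    ∃ x ∉ S, ∀ j, (θ j).Realize (Sum.elim c fun _ => x) := by
  classical
  obtain ⟨s, hs⟩ := (hS.insert (Classical.arbitrary (Ultrapower M))).exists_eq_range
    (Set.insert_nonempty _ _)
  -- The enumerated points to avoid become parameters, and the `j`-th formula also demands `x ≠ s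
  -- j`.
  let ψ : ℕ → L.Formula ((α ⊕ ℕ) ⊕ Unit) := fun j =>
    (θ j).relabel (Sum.map Sum.inl id) ⊓
      (Term.equal (var (Sum.inr ())) (var (Sum.inl (Sum.inr j)))).not
  have hψ : ∀ j (x : Unit → Ultrapower M), (ψ j).Realize (Sum.elim (Sum.elim c s) x) ↔
      (θ j).Realize (Sum.elim c fun _ => x ()) ∧ x () ≠ s j := by
    intro j x
    have : Sum.elim (Sum.elim c s) x ∘ Sum.map Sum.inl id = Sum.elim c fun _ => x () := by
      ext (i | i) <;> rfl
    simp [ψ, Formula.realize_relabel, this]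
  obtain ⟨x, hx⟩ := Ultrapower.exists_realize ψ (Sum.elim c s) fun k => by
    obtain ⟨x, hx, hx'⟩ := (h k).exists_notMem_finset ((Finset.range k).image s)
    refine ⟨fun _ => x, fun j hj => (hψ j _).2 ⟨hx j hj, fun hxs => hx' ?_⟩⟩
    exact Finset.mem_image.2 ⟨j, Finset.mem_range.2 hj, hxs.symm⟩
  simp only [hψ] at hx
  refine ⟨x (), fun hxS => ?_, fun j => (hx j).1⟩
  have : x () ∈ Set.range s := hs ▸ Set.mem_insert_of_mem _ hxS
  obtain ⟨j, hj⟩ := this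
  exact (hx j).2 hj.symm

/-- A variant of `Ultrapower.exists_notMem` for definable conditions. -/
theorem Ultrapower.exists_notMem_of_definable {α : Type} (S : ℕ → (α ⊕ Unit → Ultrapower M) → Prop)
    (hS : ∀ j, BothDefinable L (S j) (S j)) (c : α → Ultrapower M)
    (h : ∀ k, {x : Ultrapower M | ∀ j < k, S j (Sum.elim c fun _ => x)}.Infinite)
    {X : Set (Ultrapower M)} (hX : X.Countable) :
    ∃ x ∉ X, ∀ j, S j (Sum.elim c fun _ => x) := by
  choose θ hθ _ using hS
  obtain ⟨x, hx, hx'⟩ := Ultrapower.exists_notMem θ c (fun k => by simpa only [hθ] using h k) hX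
  exact ⟨x, hx, fun j => (hθ j _).1 (hx' j)⟩

end Saturation

namespace TripleGeometry

theorem isSet_of_fibreCard {N : Type*} [tripleLanguage.Structure N] (G : TripleGeometry N)
    {n : ℕ} {u v : N} (h : FibreCard n u v) : IsSet u ∧ IsSet v := by
  obtain ⟨⟨z, -, hz⟩, -⟩ := h
  obtain ⟨h₁, h₂⟩ := hz 0
  rw [G.isFst_iff] at h₁
  rw [G.isSnd_iff] at h₂
  rw [h₁.2, h₂.2]
  exact ⟨G.isSet_fst _ h₁.1, G.isSet_snd _ h₁.1⟩

/-- This makes "standard of size `n`" definable, so that saturation can be applied to the abstract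
data `std` and `supp`. -/
theorem fibreCard_self_iff {N : Type*} [tripleLanguage.Structure N] (G : TripleGeometry N)
    {n : ℕ} {v : N} : FibreCard n v v ↔ v ∈ G.std ∧ (G.supp v).card = n := by
  constructor
  · intro h
    have hs := G.isSet_of_fibreCard h
    rw [fibreCard_iff] at h
    have hfin : (fibre v v).Finite := by
      rw [← Set.encard_lt_top_iff, h]
      norm_cast
      exact ENat.natCast_lt_top _
    obtain ⟨hv, -, -⟩ := G.std_of_finite_fibre v v hs.1 hs.1 hfin
    rw [G.encard_fibre v hv v hv subset_rfl] at h
    norm_cast at h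
    exact ⟨hv, by omega⟩
  · rintro ⟨hv, rfl⟩
    rw [fibreCard_iff, G.encard_fibre v hv v hv subset_rfl]

theorem isAtom_iff {N : Type*} [tripleLanguage.Structure N] (G : TripleGeometry N)
    {x : N} : G.IsAtom x ↔ FibreCard 1 x x := by
  rw [G.fibreCard_self_iff, Finset.card_eq_one]
  constructor
  · exact fun h => ⟨h.1, x, h.2⟩
  · rintro ⟨hx, a, ha⟩
    have ha' := G.isAtom_of_mem_supp hx (x := a) (by simp [ha])
    rwa [← G.supp_injOn hx ha'.1 (ha.trans ha'.2.symm)] at ha'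

theorem exists_supp_card {N : Type*} [tripleLanguage.Structure N] (G : TripleGeometry N) (n : ℕ) :
    ∃ v ∈ G.std, (G.supp v).card = n := by
  obtain ⟨s, hs, rfl⟩ := G.infinite_atoms.exists_subset_card_eq n
  obtain ⟨v, hv, h⟩ := G.exists_supp s hs
  exact ⟨v, hv, by rw [h]⟩

open BothDefinable in
-- Each kind of fresh element realizes a countable set of formulas whose finite parts have
-- infinitely many solutions. For nonstandard sets these formulas exclude every finite size.
theorem isRich_univ {M : Type u} [tripleLanguage.Structure M] [Nonempty M]
    (G : TripleGeometry (Ultrapower M)) : G.IsRich Set.univ {S | S.Countable} where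
  insert_mem S hS x := Set.Countable.insert x hS
  exists_atom S hS := by
    obtain ⟨x, hx, h⟩ := Ultrapower.exists_notMem_of_definable (L := tripleLanguage) (α := Empty)
      (fun _ x => FibreCard 1 (x (Sum.inr ())) (x (Sum.inr ()))) (fun _ => fibreCard _ _ _)
      Empty.elim (fun k => G.infinite_atoms.mono fun x hx j hj => G.isAtom_iff.1 hx) hS
    exact ⟨x, trivial, hx, G.isAtom_iff.2 (h 0)⟩
  exists_nonstd S hS := by
    obtain ⟨x, hx, h⟩ := Ultrapower.exists_notMem_of_definable (L := tripleLanguage) (α := Empty)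
      (fun j x => IsSet (x (Sum.inr ())) ∧ ¬ FibreCard j (x (Sum.inr ())) (x (Sum.inr ())))
      (fun _ => (isSet _).and (fibreCard _ _ _).not) Empty.elim (fun k => by
        -- Standard sets of sizes `k`, `k + 1`, … avoid all sizes below `k`.
        choose v hv hv' using fun n => G.exists_supp_card (k + n)
        refine Set.infinite_of_injective_forall_mem (f := v) (fun m n hmn => ?_)
          fun n j hj => ⟨G.isSet_of_std _ (hv n), fun hc => ?_⟩
        · have := hv' m
          rw [hmn, hv'] at this
          omega
        · have := (G.fibreCard_self_iff.1 hc).2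
          have := hv' n
          simp only [Sum.elim_inr] at *
          omega) hS
    exact ⟨x, trivial, hx, (h 0).1, fun hs => (h _).2 (G.fibreCard_self_iff.2 ⟨hs, rfl⟩)⟩
  exists_fibre S hS u _ v _ _ _ huv := by
    obtain ⟨x, hx, h⟩ := Ultrapower.exists_notMem_of_definable (L := tripleLanguage) (α := Fin 2)
      (fun _ x => IsFst (x (Sum.inl 0)) (x (Sum.inr ())) ∧ IsSnd (x (Sum.inl 1)) (x (Sum.inr ())))
      (fun _ => (isFst _ _).and (isSnd _ _))
      ![u, v] (fun k => huv.mono fun x hx j hj => hx) hS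
    exact ⟨x, trivial, hx, h 0⟩
  fibre_subset _ _ _ _ _ _ _ := Set.subset_univ _
  mem_of_supp _ _ _ := trivial

end TripleGeometry

/-! ### Realizing types in the ultrapower -/

section Types

variable {L : FirstOrder.Language.{u, v}} {M : Type w} [L.Structure M] [Nonempty M]

theorem realize_iExs_iInf {R : Type*} [L.Structure R] {α : Type} [Finite α] (k : ℕ)
    (φ : ℕ → L.Formula α) :
    Sentence.Realize R (((Formula.iInf fun j : Fin k => φ j).relabel Sum.inr :
        L.Formula (Empty ⊕ α)).iExs α) ↔ ∃ b : α → R, ∀ j < k, (φ j).Realize b := by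
  simp only [Sentence.Realize, Formula.realize_iExs, Formula.realize_relabel,
    Sum.elim_comp_inr, Formula.realize_iInf]
  exact exists_congr fun b => ⟨fun h j hj => h ⟨j, hj⟩, fun h j => h j j.2⟩

/-- A complete type over the complete theory of `M` is finitely satisfiable in `M`. -/
theorem exists_realize_of_mem_completeType {α : Type} [Finite α]
    (p : (L.completeTheory M).CompleteType α) (k : ℕ) (φ : ℕ → L.Formula α)
    (hφ : ∀ j, Formula.equivSentence (φ j) ∈ p) : ∃ b : α → M, ∀ j < k, (φ j).Realize b := by
  obtain ⟨Q, ⟨b, rfl⟩⟩ := Theory.exists_modelType_is_realized_in _ p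
  simp only [Theory.CompleteType.formula_mem_typeOf] at hφ
  have hc := completeTheory.isComplete L M
  rw [← realize_iExs_iInf]
  refine (hc.realize_sentence_iff _ M).2 ((hc.realize_sentence_iff _ Q).1 ?_)
  exact (realize_iExs_iInf k φ).2 ⟨b, fun j _ => hφ j⟩

/-- A complete type over a countable set `A` of parameters is realized in the ultrapower. -/
theorem exists_realize_completeType [Countable L.Symbols] {A : Set M} (hA : A.Countable) {n : ℕ}
    (p : (L[[A]].completeTheory M).CompleteType (Fin n)) :
    ∃ b : Fin n → Ultrapower M, ∀ φ : L[[A]].Formula (Fin n),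
      Formula.equivSentence φ ∈ p ↔
        Formula.Realize (L := L) (BoundedFormula.constantsVarsEquiv φ : L.Formula (A ⊕ Fin n))
          (Sum.elim (fun a => Ultrapower.diag (a : M)) b) := by
  have : Countable A := hA
  let F : Set (L[[A]].Formula (Fin n)) := {φ | Formula.equivSentence φ ∈ p}
  -- Nonemptiness allows an enumeration of the type by `ℕ`.
  have hF : F.Nonempty := by
    by_contra! h
    have h₁ : (⊥ : L[[A]].Formula (Fin n)) ∉ F := by simp [h]
    have h₂ : (⊥ : L[[A]].Formula (Fin n)).not ∉ F := by simp [h]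
    exact h₂ ((p.not_mem_iff _).2 h₁)
  obtain ⟨φ, hφ⟩ := (Set.to_countable F).exists_eq_range hF
  have hφp : ∀ j, Formula.equivSentence (φ j) ∈ p := fun j => by
    have : φ j ∈ F := hφ ▸ ⟨j, rfl⟩
    exact this
  obtain ⟨b, hb⟩ := Ultrapower.exists_realize (L := L) (M := M)
    (fun j => (BoundedFormula.constantsVarsEquiv (φ j) : L.Formula (A ⊕ Fin n)))
    (fun a => Ultrapower.diag (a : M)) (fun k => by
      obtain ⟨b, hb⟩ := exists_realize_of_mem_completeType p k φ hφp
      refine ⟨fun i => Ultrapower.diag (b i), fun j hj => ?_⟩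
      have h₁ : (Sum.elim (fun a : A => Ultrapower.diag (a : M)) fun i => Ultrapower.diag (b i)) =
          fun i => Ultrapower.diag (Sum.elim (fun a : A => (a : M)) b i) := by
        ext (i | i) <;> rfl
      rw [h₁, Ultrapower.realize_diag]
      exact BoundedFormula.realize_constantsVarsEquiv.2 (hb j hj))
  have key : ∀ φ : L[[A]].Formula (Fin n), Formula.equivSentence φ ∈ p →
      Formula.Realize (L := L) (BoundedFormula.constantsVarsEquiv φ : L.Formula (A ⊕ Fin n))
          (Sum.elim (fun a => Ultrapower.diag (a : M)) b) := by
    intro ψ hψ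
    have : ψ ∈ Set.range φ := hφ ▸ hψ
    obtain ⟨j, rfl⟩ := this
    exact hb j
  refine ⟨b, fun ψ => ⟨key ψ, fun h => ?_⟩⟩
  by_contra hψ
  exact key ψ.not ((p.not_mem_iff _).2 hψ) h

end Types

/-! ### Countable closed sets and countable rich sets -/

namespace TripleGeometry

variable {N : Type*} [tripleLanguage.Structure N] (G : TripleGeometry N)

/-- A set is closed if it contains the coordinates and the elements of its members. -/
structure IsClosedSet (C : Set N) : Prop where
  fst_mem : ∀ z ∈ C, ¬ IsSet z → G.fst z ∈ C
  snd_mem : ∀ z ∈ C, ¬ IsSet z → G.snd z ∈ C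
  supp_mem : ∀ v ∈ C, v ∈ G.std → ∀ x ∈ G.supp v, x ∈ C

variable {G}

theorem IsClosedSet.isPartialAut {C : Set N} (h : G.IsClosedSet C) :
    G.IsPartialAut ((fun x => (x, x)) '' C) where
  inj := by
    rintro _ ⟨a, -, rfl⟩ _ ⟨b, -, rfl⟩
    rfl
  isSet := by
    rintro _ ⟨a, -, rfl⟩
    rfl
  std := by
    rintro _ ⟨a, -, rfl⟩
    rfl
  fst := by
    rintro _ ⟨a, ha, rfl⟩ h'
    exact ⟨_, h.fst_mem a ha h', rfl⟩
  snd := by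
    rintro _ ⟨a, ha, rfl⟩ h'
    exact ⟨_, h.snd_mem a ha h', rfl⟩
  supp := by
    rintro _ ⟨a, ha, rfl⟩ h' x hx
    exact ⟨x, hx, _, h.supp_mem a ha h' x hx, rfl⟩
  supp' := by
    rintro _ ⟨a, ha, rfl⟩ h' x hx
    exact ⟨x, hx, _, h.supp_mem a ha h' x hx, rfl⟩

variable (G)

/-- One round of adding coordinates and then elements suffices: coordinates are sets, elements are
atoms, and an atom has only itself as element. -/
theorem exists_isClosedSet {A : Set N} (hA : A.Countable) :
    ∃ C, A ⊆ C ∧ C.Countable ∧ G.IsClosedSet C := by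
  let A' : Set N := A ∩ {z | ¬ IsSet z}
  have hA' : A'.Countable := hA.mono Set.inter_subset_left
  let B : Set N := A ∪ (G.fst '' A' ∪ G.snd '' A')
  have hB : B.Countable := hA.union ((hA'.image _).union (hA'.image _))
  let C : Set N := B ∪ ⋃ v ∈ B ∩ G.std, (G.supp v : Set N)
  have hCset : ∀ z ∈ C, ¬ IsSet z → z ∈ A' := by
    rintro z (hz | hz) hzs
    · rcases hz with hz | ⟨a, ha, rfl⟩ | ⟨a, ha, rfl⟩
      · exact ⟨hz, hzs⟩
      · exact absurd (G.isSet_fst a ha.2) hzs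
      · exact absurd (G.isSet_snd a ha.2) hzs
    · simp only [Set.mem_iUnion] at hz
      obtain ⟨v, hv, hz⟩ := hz
      exact absurd (G.isSet_of_std z (G.std_of_mem_supp v hv.2 z hz)) hzs
  refine ⟨C, fun a ha => Or.inl (Or.inl ha), hB.union ?_, ?_, ?_, ?_⟩
  · exact (hB.mono Set.inter_subset_left).biUnion fun v _ => (G.supp v).countable_toSet
  · exact fun z hz hzs => Or.inl (Or.inr (Or.inl ⟨z, hCset z hz hzs, rfl⟩))
  · exact fun z hz hzs => Or.inl (Or.inr (Or.inr ⟨z, hCset z hz hzs, rfl⟩))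
  · rintro v (hv | hv) hvs x hx
    · exact Or.inr (Set.mem_biUnion (show v ∈ B ∩ G.std from ⟨hv, hvs⟩) hx)
    · simp only [Set.mem_iUnion] at hv
      obtain ⟨w, hw, hv⟩ := hv
      rw [G.supp_of_mem_supp w hw.2 v hv, Finset.mem_singleton] at hx
      rw [hx]
      exact Or.inr (Set.mem_biUnion hw hv)

theorem exists_countable_infinite {N : Type*} {p : N → Prop}
    (h : ∀ S : Set N, S.Countable → ∃ x ∉ S, p x) {C : Set N} (hC : C.Countable) :
    ∃ W : Set N, W.Countable ∧ W.Infinite ∧ ∀ x ∈ W, x ∉ C ∧ p x := by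
  have hinf : {x | x ∉ C ∧ p x}.Infinite := fun hfin => by
    obtain ⟨x, hx, hpx⟩ := h _ (hC.union hfin.countable)
    exact hx (Or.inr ⟨fun hxC => hx (Or.inl hxC), hpx⟩)
  let e := hinf.natEmbedding
  refine ⟨Set.range fun i => (e i : N), Set.countable_range _,
    Set.infinite_range_of_injective fun i j hij => e.injective (Subtype.ext hij), ?_⟩
  rintro _ ⟨i, rfl⟩
  exact (e i).2

theorem exists_mem_notMem_of_infinite {N : Type*} {W C S : Set N} (hW : W.Infinite)
    (hWC : ∀ x ∈ W, x ∉ C) (hS : (S \ C).Finite) : ∃ x ∈ W, x ∉ S := by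
  obtain ⟨x, hxW, hx⟩ := hW.exists_notMem_finite hS
  exact ⟨x, hxW, fun hxS => hx ⟨hxS, hWC x hxW⟩⟩

/-- Add to `C` infinitely many new atoms `W`, new nonstandard sets `Y`, all standard sets `V` over
`C ∪ W`, and a countable part of each fibre. The supplies are infinite outside `C`, so a range that
is finite outside `C` never exhausts them. -/
theorem exists_countable_isRich (hG : G.IsRich Set.univ {S | S.Countable}) {C : Set N}
    (hC : C.Countable) : ∃ U, C ⊆ U ∧ U.Countable ∧ G.IsRich U {S | (S \ C).Finite} := by
  obtain ⟨W, hWc, hWi, hW⟩ := exists_countable_infinite (p := G.IsAtom) (fun S hS => by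
    obtain ⟨x, -, h⟩ := hG.exists_atom S hS
    exact ⟨x, h⟩) hC
  obtain ⟨Y, hYc, hYi, hY⟩ := exists_countable_infinite (p := fun x => IsSet x ∧ x ∉ G.std)
    (fun S hS => by
      obtain ⟨x, -, h⟩ := hG.exists_nonstd S hS
      exact ⟨x, h⟩) hC
  have hF : ∀ u v : N, ∃ F : Set N, F.Countable ∧ F ⊆ fibre u v ∧ (IsSet u → IsSet v →
      ((fibre u v).Finite → fibre u v ⊆ F) ∧ ((fibre u v).Infinite → (F \ C).Infinite)) := by
    intro u v
    by_cases hfin : (fibre u v).Finite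
    · exact ⟨fibre u v, hfin.countable, subset_rfl, fun _ _ =>
        ⟨fun _ => subset_rfl, fun h => absurd hfin h⟩⟩
    by_cases huv : IsSet u ∧ IsSet v
    · obtain ⟨F, hFc, hFi, hF⟩ := exists_countable_infinite (p := fun x => x ∈ fibre u v)
        (fun S hS => by
          obtain ⟨x, -, h⟩ := hG.exists_fibre S hS u trivial v trivial huv.1 huv.2 hfin
          exact ⟨x, h⟩) hC
      exact ⟨F, hFc, fun x hx => (hF x hx).2, fun _ _ => ⟨fun h => absurd h hfin, fun _ =>
        hFi.mono fun x hx => ⟨hx, (hF x hx).1⟩⟩⟩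
    · exact ⟨∅, Set.countable_empty, Set.empty_subset _, fun h₁ h₂ => absurd ⟨h₁, h₂⟩ huv⟩
  choose F hFc hFs hF using hF
  have hFset : ∀ u v x, x ∈ F u v → ¬ IsSet x := fun u v x hx =>
    (G.mem_fibre_iff.1 (hFs u v hx)).1
  let V : Set N := {v | v ∈ G.std ∧ (G.supp v : Set N) ⊆ C ∪ W}
  have hV : V.Countable := by
    refine Set.countable_of_injective_of_countable_image (f := fun v => (G.supp v : Set N))
      (fun v hv w hw hvw => G.supp_injOn hv.1 hw.1 (Finset.coe_injective hvw)) ?_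
    refine (Set.countable_ofPred_finite_subset (hC.union hWc)).mono ?_
    rintro _ ⟨v, hv, rfl⟩
    exact ⟨(G.supp v).finite_toSet, hv.2⟩
  let U₀ : Set N := C ∪ (W ∪ (Y ∪ V))
  have hU₀ : U₀.Countable := hC.union (hWc.union (hYc.union hV))
  let U : Set N := U₀ ∪ ⋃ u ∈ U₀, ⋃ v ∈ U₀, F u v
  -- The fibres contribute only triples, so no new pairs of sets arise and the construction stops
  -- here.
  have hU : ∀ x ∈ U, IsSet x → x ∈ U₀ := by
    rintro x (hx | hx) hxs
    · exact hx
    · simp only [Set.mem_iUnion] at hx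
      obtain ⟨u, -, v, -, hx⟩ := hx
      exact absurd hxs (hFset u v x hx)
  have hFU : ∀ u ∈ U, ∀ v ∈ U, IsSet u → IsSet v → F u v ⊆ U := fun u hu v hv hus hvs x hx =>
    Or.inr (Set.mem_biUnion (hU u hu hus) (Set.mem_biUnion (hU v hv hvs) hx))
  refine ⟨U, fun x hx => Or.inl (Or.inl hx),
    hU₀.union (hU₀.biUnion fun u _ => hU₀.biUnion fun v _ => hFc u v), ?_, ?_, ?_, ?_, ?_, ?_⟩
  · intro S hS x
    exact (Set.Finite.insert x hS).subset (by
      rintro y ⟨rfl | hy, hyC⟩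
      exacts [Or.inl rfl, Or.inr ⟨hy, hyC⟩])
  · intro S hS
    obtain ⟨x, hx, hxS⟩ := exists_mem_notMem_of_infinite hWi (fun x hx => (hW x hx).1) hS
    exact ⟨x, Or.inl (Or.inr (Or.inl hx)), hxS, (hW x hx).2⟩
  · intro S hS
    obtain ⟨x, hx, hxS⟩ := exists_mem_notMem_of_infinite hYi (fun x hx => (hY x hx).1) hS
    exact ⟨x, Or.inl (Or.inr (Or.inr (Or.inl hx))), hxS, (hY x hx).2⟩
  · intro S hS u hu v hv hus hvs hinf
    obtain ⟨x, hx, hxS⟩ := exists_mem_notMem_of_infinite ((hF u v hus hvs).2 hinf)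
      (fun x hx => hx.2) hS
    exact ⟨x, hFU u hu v hv hus hvs hx.1, hxS, hFs u v hx.1⟩
  · intro u hu v hv hus hvs hfin
    exact ((hF u v hus hvs).1 hfin).trans (hFU u hu v hv hus hvs)
  · intro v hv hsupp
    refine Or.inl (Or.inr (Or.inr (Or.inr ⟨hv, fun x hx => ?_⟩)))
    have hxa := G.isAtom_of_mem_supp hv hx
    -- Every atom of `U` lies in `C ∪ W`: members of `Y` are nonstandard, and an atom in `V` has
    -- support `{x} ⊆ C ∪ W`.
    rcases hU x (hsupp x hx) (G.isSet_of_std x hxa.1) with h | h | h | h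
    · exact Or.inl h
    · exact Or.inr h
    · exact absurd hxa.1 (hY x h).2.2
    · exact h.2 (by simp [hxa.2])

variable {G}

theorem IsRich.extend_tuple {U : Set N} {small : Set (Set N)} (hU : G.IsRich U small) {n : ℕ}
    (b : Fin n → N) {f : Set (N × N)} (hf : f ∈ G.partialAuts U small) :
    ∃ g ∈ G.partialAuts U small, f ⊆ g ∧ ∃ b' : Fin n → N, ∀ i, (b i, b' i) ∈ g := by
  induction n with
  | zero => exact ⟨f, hf, subset_rfl, Fin.elim0, fun i => i.elim0⟩
  | succ n ih =>
    obtain ⟨g, hg, hfg, b', hb'⟩ := ih fun i => b i.castSucc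
    obtain ⟨k, hk, hgk, d, hd⟩ := hU.extend hg (b (Fin.last n))
    refine ⟨k, hk, hfg.trans hgk, Fin.snoc b' d, Fin.lastCases ?_ fun i => ?_⟩
    · simpa using hd
    · simpa using hgk (hb' i)

/-- Over countably many parameters, countably many tuples realize all types. -/
theorem exists_countable_tuples (hG : G.IsRich Set.univ {S | S.Countable}) {α : Type*}
    [Countable α] (c : α → N) (n : ℕ) : ∃ B : Set (Fin n → N), B.Countable ∧
      ∀ b : Fin n → N, ∃ b' ∈ B, ∀ φ : tripleLanguage.Formula (α ⊕ Fin n),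
        φ.Realize (Sum.elim c b) ↔ φ.Realize (Sum.elim c b') := by
  obtain ⟨C, hAC, hC, hCcl⟩ := G.exists_isClosedSet (Set.countable_range c)
  obtain ⟨U, hCU, hUc, hU⟩ := G.exists_countable_isRich hG hC
  refine ⟨{b | ∀ i, b i ∈ U}, Set.countable_pi fun _ => hUc, fun b => ?_⟩
  -- Starting from the identity on `C` keeps the parameters fixed.
  have hf : (fun x => (x, x)) '' C ∈ G.partialAuts U {S | (S \ C).Finite} := by
    refine ⟨hCcl.isPartialAut, ?_, ?_⟩
    · rintro _ ⟨x, hx, rfl⟩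
      exact hCU hx
    · simp [Set.image_image]
  obtain ⟨g, hg, hfg, b', hb'⟩ := hU.extend_tuple b hf
  refine ⟨b', fun i => hg.2.1 _ (hb' i), fun φ => hg.1.realize_iff hG (hg.1.countable ?_) φ _ _ ?_⟩
  · exact (hC.union hg.2.2.countable).mono fun x hx => by
      by_cases hxC : x ∈ C
      exacts [Or.inl hxC, Or.inr ⟨hx, hxC⟩]
  · rintro (a | i)
    · exact hfg ⟨_, hAC ⟨a, rfl⟩, rfl⟩
    · exact hb' i

end TripleGeometry

/-! ### Stability of the theory -/

instance : Countable tripleLanguage.Symbols := by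
  have h₁ : IsEmpty (Σ l, tripleLanguage.Functions l) := ⟨fun ⟨l, f⟩ => isEmptyElim f⟩
  have h₂ : Countable (Σ l, tripleLanguage.Relations l) := by
    refine Set.countable_univ_iff.1 ((Set.toFinite ({⟨1, TripleRel.P⟩, ⟨1, TripleRel.R⟩,
      ⟨2, TripleRel.Q₁⟩, ⟨2, TripleRel.Q₂⟩} : Set (Σ l, TripleRel l))).countable.mono ?_)
    rintro ⟨l, _ | _ | _ | _⟩ - <;> simp
  exact inferInstanceAs (Countable (_ ⊕ _))

theorem isOmegaStable_tripleTheory : IsOmegaStable.{0, 0, w} tripleTheory := by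
  intro M _ _ hM A hA n
  have hN : Ultrapower M ⊨ tripleTheory := by
    refine ⟨fun φ hφ => (Ultraproduct.sentence_realize φ).2 ?_⟩
    exact Filter.Eventually.of_forall fun _ => hM.realize_of_mem φ hφ
  obtain ⟨G⟩ := exists_geometry hN
  have : Countable A := hA
  obtain ⟨B, hB, hBr⟩ := TripleGeometry.exists_countable_tuples G.isRich_univ
    (fun a : A => Ultrapower.diag (a : M)) n
  choose b hb using fun p => exists_realize_completeType (L := tripleLanguage) (n := n) hA p
  choose b' hb' hbb' using hBr
  have : Countable B := hB
  -- Send a type to a tuple of `B` with the same formulas as its realization; the tuple determines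
  -- the type.
  refine Function.Injective.countable (f := fun p => (⟨b' (b p), hb' _⟩ : B)) fun p q hpq => ?_
  have hpq : b' (b p) = b' (b q) := congrArg Subtype.val hpq
  have key : ∀ (p) (φ : tripleLanguage[[A]].Formula (Fin n)), Formula.equivSentence φ ∈ p ↔
      Formula.Realize (L := tripleLanguage)
        (BoundedFormula.constantsVarsEquiv φ : tripleLanguage.Formula (A ⊕ Fin n))
        (Sum.elim (fun a => Ultrapower.diag (a : M)) (b' (b p))) :=
    fun p φ => (hb p φ).trans (hbb' (b p) _)
  refine SetLike.ext fun σ => ?_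
  obtain ⟨φ, rfl⟩ := Formula.equivSentence.surjective σ
  rw [key, key, hpq]

/-! ### The independence property by compactness -/

open Classical in
theorem realize_ite_not {L : FirstOrder.Language.{u, v}} {N : Type*} [L.Structure N] {α : Type*}
    (p : Prop) (φ : L.Formula α) (x : α → N) :
    (if p then φ else φ.not).Realize x ↔ (φ.Realize x ↔ p) := by
  by_cases hp : p <;> simp [hp]

/-- By compactness, a theory has the independence property as soon as, in some model, some formula
cuts out all subsets of arbitrarily large finite sets. -/
theorem hasIndependenceProperty_of_finite {L : FirstOrder.Language.{u, v}} (T : L.Theory)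
    {M : Type w} [L.Structure M] [Nonempty M] (hM : M ⊨ T) {m k : ℕ}
    (φ : L.Formula (Fin m ⊕ Fin k))
    (h : ∀ n : ℕ, ∃ (a : ℕ → Fin m → M) (b : Set ℕ → Fin k → M), ∀ i < n, ∀ s : Set ℕ,
      φ.Realize (Sum.elim (a i) (b s)) ↔ i ∈ s) : HasIndependenceProperty T := by
  classical
  -- One constant for each coordinate of each `a i` and each `b s`; the theory `D n` constrains only
  -- the indices `i < n`, but all `s`.
  let γ : Type := (ℕ × Fin m) ⊕ (Set ℕ × Fin k)
  let ρ : ℕ → Set ℕ → Fin m ⊕ Fin k → γ := fun i s =>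
    Sum.elim (fun j => Sum.inl (i, j)) fun j => Sum.inr (s, j)
  let ψ : ℕ → Set ℕ → L.Formula γ := fun i s =>
    if i ∈ s then φ.relabel (ρ i s) else (φ.relabel (ρ i s)).not
  let D : ℕ → L[[γ]].Theory := fun n => (L.lhomWithConstants γ).onTheory T ∪
    {σ | ∃ i < n, ∃ s, σ = Formula.equivSentence (ψ i s)}
  have hD : Monotone D := fun n₁ n₂ hn => Set.union_subset_union_right _ <| by
    rintro _ ⟨i, hi, s, rfl⟩
    exact ⟨i, hi.trans_le hn, s, rfl⟩
  have hsat : Theory.IsSatisfiable (⋃ n, D n) := by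
    rw [Theory.isSatisfiable_directed_union_iff hD.directed_le]
    intro n
    obtain ⟨a, b, hab⟩ := h n
    let x : γ → M := Sum.elim (fun p => a p.1 p.2) fun p => b p.1 p.2
    let : (constantsOn γ).Structure M := constantsOn.structure x
    have : M ⊨ D n := by
      refine Theory.Model.union ((LHom.onTheory_model _ T).2 hM) ⟨?_⟩
      rintro _ ⟨i, hi, s, rfl⟩
      rw [Formula.realize_equivSentence]
      refine (realize_ite_not _ _ _).2 (Iff.trans (Formula.realize_relabel.trans ?_) (hab i hi s))
      rw [iff_iff_eq]
      congr 1
      ext (j | j) <;> rfl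
    exact Theory.Model.isSatisfiable M
  obtain ⟨Q⟩ := hsat
  have hsub : ∀ n, D n ⊆ ⋃ n, D n := fun n => Set.subset_iUnion D n
  let N : Theory.ModelType T := (Q.subtheoryModel
    (Set.subset_union_left.trans (hsub 0))).reduct (L.lhomWithConstants γ)
  let x : γ → N := fun c => (L.con c : Q)
  refine ⟨m, k, φ, N, fun i j => x (Sum.inl (i, j)), fun s j => x (Sum.inr (s, j)), fun i s => ?_⟩
  have h₁ : Q ⊨ Formula.equivSentence (ψ i s) :=
    Q.is_model.realize_of_mem _ (hsub (i + 1) (Or.inr ⟨i, Nat.lt_succ_self i, s, rfl⟩))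
  let : L.Structure Q := (L.lhomWithConstants γ).reduct Q
  have : (L.lhomWithConstants γ).IsExpansionOn Q := LHom.isExpansionOn_reduct _ _
  rw [Formula.realize_equivSentence] at h₁
  refine Iff.trans (Iff.trans ?_ Formula.realize_relabel.symm) ((realize_ite_not _ _ _).1 h₁)
  rw [iff_iff_eq]
  congr 1
  ext (j | j) <;> rfl

/-! ### Weakly generic pairs -/

section Pair

open BothDefinable

variable {M₁ : Type u} [tripleLanguage.Structure M₁] (M : tripleLanguage.ElementarySubstructure M₁)

theorem fibreGE_coe_iff (n : ℕ) (x y : M) : FibreGE n (x : M₁) (y : M₁) ↔ FibreGE n x y := by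
  obtain ⟨φ, h₁, h₂⟩ := fibreGE (M := M) (N := M₁) (α := Fin 2) n 0 1
  have h := M.subtype.map_formula φ ![x, y]
  rw [h₁, h₂] at h
  exact h

theorem mem_fibre_coe_iff (x y z : M) : (z : M₁) ∈ fibre (x : M₁) (y : M₁) ↔ z ∈ fibre x y := by
  obtain ⟨φ, h₁, h₂⟩ := (isFst (M := M) (N := M₁) (α := Fin 3) 0 2).and (isSnd 1 2)
  have h := M.subtype.map_formula φ ![x, y, z]
  rw [h₁, h₂] at h
  exact h

/-- By elementarity `M₁` also has no more than `k` triples over `(x, y)`, and `M` already supplies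
`k`. -/
theorem fibre_subset_of_finite {x y : M} (h : (fibre x y).Finite) :
    fibre (x : M₁) (y : M₁) ⊆ M := by
  obtain ⟨k, hk⟩ : ∃ k : ℕ, (fibre x y).encard = k := h.exists_encard_eq_coe
  have h₁ : ¬ FibreGE (k + 1) (x : M₁) (y : M₁) := by
    rw [fibreGE_coe_iff, fibreGE_iff, hk]
    norm_cast
    omega
  rw [fibreGE_iff, not_le] at h₁
  have h₂ : ((↑) '' fibre x y : Set M₁) ⊆ fibre (x : M₁) (y : M₁) := by
    rintro _ ⟨z, hz, rfl⟩
    exact (mem_fibre_coe_iff M x y z).2 hz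
  have h₃ : ((↑) '' fibre x y : Set M₁).encard = k := by
    rw [Subtype.val_injective.encard_image, hk]
  have h₄ := (h.image ((↑) : M → M₁)).eq_of_subset_of_encard_le h₂ (by
    rw [h₃]
    push_cast at h₁
    exact Order.le_of_lt_add_one h₁)
  rw [← h₄]
  rintro _ ⟨z, -, rfl⟩
  exact z.2

theorem exists_mem_fibre_notMem (hM : IsWeaklyGeneric M) {x y : M} (h : (fibre x y).Infinite) :
    ∃ z ∉ M, z ∈ fibre (x : M₁) (y : M₁) := by
  obtain ⟨φ, h₁, h₂⟩ := (isFst (M := M) (N := M₁) (α := Fin 2 ⊕ Unit) (Sum.inl 0)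
    (Sum.inr ())).and (isSnd (Sum.inl 1) (Sum.inr ()))
  obtain ⟨z, hz, hz'⟩ := hM 2 φ ![x, y] (by simp only [h₁]; exact h)
  exact ⟨z, hz, (h₂ _).1 hz'⟩

/-- The formula "all triples over `(x, y)` lie in `M`" defines inclusion between standard sets of
`M`. It is tested on atoms `w i` against finite sets of atoms. -/
theorem hasIndependenceProperty_pairTheory (hM₁ : M₁ ⊨ tripleTheory) (hM : IsWeaklyGeneric M) :
    HasIndependenceProperty (pairTheory M) := by
  classical
  have hMT : M ⊨ tripleTheory := (M.theory_model_iff _).2 hM₁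
  obtain ⟨G⟩ := exists_geometry hMT
  let w := G.infinite_atoms.natEmbedding
  have hw : ∀ i, G.IsAtom (w i) := fun i => (w i).2
  let : nameLanguage.Structure M₁ := nameStructure (M : Set M₁)
  have : Nonempty M₁ := ⟨(w 0 : M)⟩
  have hdef : BothDefinable (tripleLanguage.sum nameLanguage)
      (fun x : Fin 1 ⊕ Fin 1 → M₁ => ∀ z, IsFst (x (Sum.inl 0)) z → IsSnd (x (Sum.inr 0)) z → z ∈ M)
      (fun x : Fin 1 ⊕ Fin 1 → M₁ =>
        ∀ z, IsFst (x (Sum.inl 0)) z → IsSnd (x (Sum.inr 0)) z → z ∈ M) :=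
    forall_elem <| (rel₂ (L := tripleLanguage.sum nameLanguage) (Sum.inl TripleRel.Q₁) _ _).imp <|
      (rel₂ (L := tripleLanguage.sum nameLanguage) (Sum.inl TripleRel.Q₂) _ _).imp <|
      rel₁ (L := tripleLanguage.sum nameLanguage) (Sum.inr NameRel.name) _
  obtain ⟨φ, hφ, -⟩ := hdef
  refine hasIndependenceProperty_of_finite (pairTheory M) (M := M₁)
    ⟨fun _ hσ => hσ⟩ φ fun n => ?_
  -- Supports are finite, so `s` is cut down to the indices below `n`.
  have hset : ∀ s : Set ℕ, ∃ v ∈ G.std,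
      G.supp v = ((Finset.range n).filter (· ∈ s)).image fun i => (w i : M) := fun s =>
    G.exists_supp _ fun x hx => by
      obtain ⟨i, -, rfl⟩ := Finset.mem_image.1 hx
      exact hw i
  choose v hv hvs using hset
  refine ⟨fun i _ => (w i : M), fun s _ => v s, fun i hi s => ?_⟩
  rw [hφ]
  have hiff : G.supp (w i) ⊆ G.supp (v s) ↔ i ∈ s := by
    rw [(hw i).2, hvs, Finset.singleton_subset_iff, Finset.mem_image]
    constructor
    · rintro ⟨j, hj, hij⟩
      rw [← w.injective (Subtype.ext hij)]
      exact (Finset.mem_filter.1 hj).2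
    · exact fun his => ⟨i, Finset.mem_filter.2 ⟨Finset.mem_range.2 hi, his⟩, rfl⟩
  constructor
  · intro h
    by_contra his
    have hinf : (fibre (w i : M) (v s)).Infinite := fun hfin => his <| hiff.1
      (G.std_of_finite_fibre _ _ (G.isSet_of_std _ (hw i).1) (G.isSet_of_std _ (hv s)) hfin).2.2
    obtain ⟨z, hz, h₁, h₂⟩ := exists_mem_fibre_notMem M hM hinf
    exact hz (h z h₁ h₂)
  · intro his z h₁ h₂
    refine fibre_subset_of_finite M (x := (w i : M)) (y := v s) ?_ ⟨h₁, h₂⟩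
    rw [← Set.encard_lt_top_iff, G.encard_fibre _ (hw i).1 _ (hv s) (hiff.2 his)]
    norm_cast
    exact ENat.natCast_lt_top _

end Pair

end GenericPair

theorem mainTheorem5 :
    GenericPair.IsOmegaStable.{0, 0, u} GenericPair.tripleTheory ∧
      ∀ (M₁ : Type u) [GenericPair.tripleLanguage.Structure M₁]
        (M : GenericPair.tripleLanguage.ElementarySubstructure M₁),
        M₁ ⊨ GenericPair.tripleTheory →
        GenericPair.IsWeaklyGeneric M →
        GenericPair.HasIndependenceProperty (GenericPair.pairTheory M) :=
  ⟨GenericPair.isOmegaStable_tripleTheory, fun _ _ M hM₁ hM =>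
    GenericPair.hasIndependenceProperty_pairTheory M hM₁ hM⟩
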